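/- For a function $P$ of $n$ complex variables (such as a Laurent polynomial) and an integer $k\ge 1$, the higher Mahler measure is $$\mu_k(P)=\int_0^1\cdots\int_0^1 \log^k\left|P\left(e^{2\pi i t_1},\ldots,e^{2\pi i t_n}\right)\right|\,dt_1\cdots dt_n ,$$ whenever this integral converges absolutely. For real $x$ with $0<|x|<1$ and integers $n\ge 2$, let $$\lambda_n(x)=(n-2)!\sum_{k=0}^{n-2}\frac{(-1)^k}{k!}\,\mathrm{Li}_{n-k}(x)\,\log^k|x|+\frac{(-1)^n}{n}\log^n|x|,\qquad \mathrm{Li}_m(x)=\sum_{j=1}^\infty\frac{x^j}{j^m},$$ be the Kummer-type polylogarithm. **Theorem.** The integral defining $\mu_2(1+x+y+z)$ converges absolutely, and $$\mu_2(1+x+y+z)=\frac{12}{\pi^2}\,\lambda_4\!\left(\tfrac12\right)-\frac{\pi^2}{5}.$$ -/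

import Mathlib

noncomputable section

/-- The point `(e^{2πi t₁}, …, e^{2πi tₙ})` of the `n`-dimensional torus. -/
def torusPoint {n : ℕ} (t : Fin n → ℝ) : Fin n → ℂ :=
  fun i => Complex.exp (2 * Real.pi * Complex.I * (t i : ℂ))

/-- The integrand `∏ⱼ log |Pⱼ(e^{2πi t₁}, …, e^{2πi tₙ})|` of the multiple Mahler measure. -/
def mahlerIntegrand {n k : ℕ} (P : Fin k → (Fin n → ℂ) → ℂ) (t : Fin n → ℝ) : ℝ :=
  ∏ j, Real.log ‖P j (torusPoint t)‖

/-- The multiple Mahler measure `μ(P₁, …, P_k)` of `k` functions in `n` variables: the integral of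
`∏ⱼ log |Pⱼ|` over the unit cube `[0,1]ⁿ`. -/
def multipleMahlerMeasure {n k : ℕ} (P : Fin k → (Fin n → ℂ) → ℂ) : ℝ :=
  ∫ t in Set.Icc (0 : Fin n → ℝ) 1, mahlerIntegrand P t

/-- The higher Mahler measure `μ_k(P) = μ(P, …, P)` (with `k` copies of `P`). -/
def higherMahlerMeasure {n : ℕ} (k : ℕ) (P : (Fin n → ℂ) → ℂ) : ℝ :=
  multipleMahlerMeasure (fun _ : Fin k => P)

/-- The polylogarithm `Li_k(x) = ∑_{m ≥ 1} x^m / m^k`, for real `x` with `|x| < 1`. -/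
def polyLog (k : ℕ) (x : ℝ) : ℝ :=
  ∑' m : ℕ, x ^ (m + 1) / ((m : ℝ) + 1) ^ k

/-- The Kummer-type polylogarithm
`λ_n(x) = (n-2)! ∑_{k=0}^{n-2} ((-1)^k / k!) Li_{n-k}(x) log^k |x| + ((-1)^n / n) log^n |x|`,
for `n ≥ 2` and real `x` with `0 < |x| < 1`. -/
def kummerLambda (n : ℕ) (x : ℝ) : ℝ :=
  ((n - 2).factorial : ℝ) *
      ∑ k ∈ Finset.range (n - 1),
        (-1 : ℝ) ^ k / (k.factorial : ℝ) * polyLog (n - k) x * Real.log |x| ^ k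
    + (-1 : ℝ) ^ n / (n : ℝ) * Real.log |x| ^ n

end

/-! Substituting z = ys turns the polynomial into (1 + x) + y(1 + s). The mean over y of log² |a +
by| depends only on A = |a| and B = |b| and is symmetric in them. For B < A it equals log² A +
Li₂(B²/A²)/2, by Parseval for log |1 + (B/A) e^{2πit}|. Since |1 + x| is distributed as 2 sin u with
u uniform on (0, π/2), the measure is 8/π² times the integral of log²(2 sin u) + Li₂(sin² v / sin²
u)/2 over 0 < v < u < π/2 (`lintegral_circleMeanLogSq_sin`).

Both summands reduce to the Euler sums S₊ = ∑ cₙ/n² and S₋ = ∑ (-1)ⁿ cₙ/n², where cₙ = 2H_{n-1}/n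
are the Taylor coefficients of log²(1 - z). The first becomes the log-sine integral of u log²(2 sin
u), read off from Re log²(1 - e^{2iu}); it is π⁴/192 + (S₋ - S₊)/4 (`integral_mul_log_two_sin_sq`).
In the second, sin v = r sin u and Tonelli leave artanh(r)/r times a dilogarithm, whose expansion
gives (S₊ + S₋)/2 - S₊/16 (`lintegral_lintegral_polyLog_sin_div_sin`).

Two ways of summing ζ(2)² give S₊ = π⁴/180. Termwise integration gives S₋ = -∫₀¹ log²(1 + x) log x /
x dx; under x = 1/t - 1 this moves to [1/2, 1], where polylogarithms at 1/2 appear and combine to S₋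
= 2λ₄(1/2) - π⁴/24. The two pieces add up to (3/2)λ₄(1/2) - π⁴/40.

On the torus only integrals of nonnegative extended-real functions are used, so every interchange is
free and absolute convergence comes with the value. -/

/-! ### Taylor coefficients of log²(1 - z) and Euler sums -/

section LogSqCoeff

open Finset Filter Topology

/-- The harmonic number `H_{n-1}`, as the sum of `1 / i` over `0 < i < n`. -/
noncomputable def harm (n : ℕ) : ℝ := ∑ i ∈ range n, 1 / (i : ℝ)

/-- The Taylor coefficients `2 H_{n-1} / n` of `log² (1 - z)`. -/
noncomputable def logSqCoeff (n : ℕ) : ℝ := 2 * harm n / n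

lemma harm_nonneg (n : ℕ) : 0 ≤ harm n := sum_nonneg fun _ _ => by positivity

lemma logSqCoeff_nonneg (n : ℕ) : 0 ≤ logSqCoeff n := by
  have := harm_nonneg n
  unfold logSqCoeff; positivity

lemma sum_antidiagonal_fst {M : Type*} [AddCommMonoid M] (f : ℕ → M) (n : ℕ) :
    ∑ p ∈ antidiagonal n, f p.1 = ∑ i ∈ range (n + 1), f i :=
  Nat.sum_antidiagonal_eq_sum_range_succ (fun i _ => f i) n

lemma sum_antidiagonal_snd {M : Type*} [AddCommMonoid M] (f : ℕ → M) (n : ℕ) :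
    ∑ p ∈ antidiagonal n, f p.2 = ∑ i ∈ range (n + 1), f i := by
  rw [← sum_antidiagonal_fst f n, ← Nat.sum_antidiagonal_swap]
  rfl

/-- `∑_{i+j=n} 1/(ij) = 2 H_{n-1} / n`. -/
lemma sum_antidiagonal_inv_mul_inv (n : ℕ) :
    ∑ p ∈ antidiagonal n, 1 / (p.1 : ℝ) * (1 / (p.2 : ℝ)) = logSqCoeff n := by
  rcases Nat.eq_zero_or_pos n with rfl | hn
  · simp [logSqCoeff]
  have hn' : (n : ℝ) ≠ 0 := by positivity
  -- Partial fractions: 1/(ij) = (1/i + 1/j)/n. With 1/0 = 0 the left side vanishes at the two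
  -- endpoints, where the bracket would leave 1/n; the indicators remove it.
  have key : ∀ p ∈ antidiagonal n, 1 / (p.1 : ℝ) * (1 / (p.2 : ℝ)) =
      (1 / (n : ℝ)) * ((1 / (p.1 : ℝ) + 1 / (p.2 : ℝ)) - (if p.1 = 0 then 1 / (n : ℝ) else 0)
        - (if p.2 = 0 then 1 / (n : ℝ) else 0)) := by
    rintro ⟨i, j⟩ hp
    rw [HasAntidiagonal.mem_antidiagonal] at hp; dsimp only at hp
    subst hp
    rcases Nat.eq_zero_or_pos i with rfl | hi <;> rcases Nat.eq_zero_or_pos j with rfl | hj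
    · simp
    · simp [hj.ne']
    · simp [hi.ne']
    · have : (i : ℝ) ≠ 0 := by positivity
      have : (j : ℝ) ≠ 0 := by positivity
      push_cast at hn' ⊢
      simp only [hi.ne', hj.ne', if_false]
      field_simp
      ring
  rw [sum_congr rfl key, ← mul_sum, sum_sub_distrib, sum_sub_distrib, sum_add_distrib,
    sum_antidiagonal_fst (fun i => 1 / (i : ℝ)), sum_antidiagonal_snd (fun i => 1 / (i : ℝ)),
    sum_antidiagonal_fst (fun i => if i = 0 then 1 / (n : ℝ) else 0),
    sum_antidiagonal_snd (fun i => if i = 0 then 1 / (n : ℝ) else 0)]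
  simp only [sum_ite_eq', mem_range, sum_range_succ _ n, hn, hn.ne', if_true, if_false,
    logSqCoeff, harm]
  field_simp
  ring

lemma hasSum_of_telescope {u : ℕ → ℝ} {f : ℕ → ℝ} {a : ℝ} (h0 : ∀ n, 0 ≤ f n)
    (hu : ∀ n, ∑ i ∈ range n, f i = u n) (ha : Tendsto u atTop (𝓝 a)) : HasSum f a := by
  rw [hasSum_iff_tendsto_nat_of_nonneg h0]
  simpa only [hu] using ha

/-- The Euler sum `∑ 2 H_{n-1} / n³ = π⁴ / 180`. -/
lemma hasSum_logSqCoeff_div_sq :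
    HasSum (fun n : ℕ => logSqCoeff n / (n : ℝ) ^ 2) (Real.pi ^ 4 / 180) := by
  have h2 := hasSum_zeta_two
  have h4 := hasSum_zeta_four
  set G : ℕ → ℝ := fun n => ∑ i ∈ range n, 1 / (i : ℝ) ^ 2 with hG
  -- ζ(2)² is summed along antidiagonals here and through increments of squared partial sums in
  -- `htel`. By `hfin` the common part 2Gₙ/n² cancels, leaving 2 ∑ cₙ/n² = ζ(4).
  have hprod : HasSum (fun n : ℕ => ∑ p ∈ HasAntidiagonal.antidiagonal n,
      1 / (p.1 : ℝ) ^ 2 * (1 / (p.2 : ℝ) ^ 2))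
      ((Real.pi ^ 2 / 6) * (Real.pi ^ 2 / 6)) := by
    have hs : Summable fun n : ℕ => ‖1 / (n : ℝ) ^ 2‖ := h2.summable.norm
    have := (summable_norm_sum_mul_antidiagonal_of_summable_norm hs hs).of_norm.hasSum
    rwa [← tsum_mul_tsum_eq_tsum_sum_antidiagonal_of_summable_norm hs hs, h2.tsum_eq] at this
  have htel : HasSum (fun n : ℕ => 2 * (G n * (1 / (n : ℝ) ^ 2)) + 1 / (n : ℝ) ^ 4)
      ((Real.pi ^ 2 / 6) * (Real.pi ^ 2 / 6)) := by
    refine hasSum_of_telescope (u := fun n => G n * G n) (fun n => ?_) (fun n => ?_)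
      (h2.tendsto_sum_nat.mul h2.tendsto_sum_nat)
    · have : 0 ≤ G n := sum_nonneg fun _ _ => by positivity
      positivity
    · induction n with
      | zero => simp [hG]
      | succ n ih =>
        rw [sum_range_succ, ih]
        have : G (n + 1) = G n + 1 / (n : ℝ) ^ 2 := sum_range_succ _ _
        rw [this]
        rcases Nat.eq_zero_or_pos n with rfl | hn
        · simp
        · field_simp; ring
  have hfin : ∀ n : ℕ, ∑ p ∈ antidiagonal n, 1 / (p.1 : ℝ) ^ 2 * (1 / (p.2 : ℝ) ^ 2) =
      2 * (G n * (1 / (n : ℝ) ^ 2)) + 2 * (logSqCoeff n / (n : ℝ) ^ 2) := by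
    intro n
    rcases Nat.eq_zero_or_pos n with rfl | hn
    · simp
    have hn' : (n : ℝ) ≠ 0 := by positivity
    -- The square of 1/(ij) = (1/i + 1/j)/n; its cross term is summed by
    -- `sum_antidiagonal_inv_mul_inv`.
    have key : ∀ p ∈ antidiagonal n, 1 / (p.1 : ℝ) ^ 2 * (1 / (p.2 : ℝ) ^ 2) =
        (1 / (n : ℝ) ^ 2) * ((1 / (p.1 : ℝ) ^ 2 + 1 / (p.2 : ℝ) ^ 2)
          - (if p.1 = 0 then 1 / (n : ℝ) ^ 2 else 0) - (if p.2 = 0 then 1 / (n : ℝ) ^ 2 else 0)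
          + 2 * (1 / (p.1 : ℝ) * (1 / (p.2 : ℝ)))) := by
      rintro ⟨i, j⟩ hp
      rw [HasAntidiagonal.mem_antidiagonal] at hp; dsimp only at hp
      subst hp
      rcases Nat.eq_zero_or_pos i with rfl | hi <;> rcases Nat.eq_zero_or_pos j with rfl | hj
      · simp
      · simp [hj.ne']
      · simp [hi.ne']
      · have : (i : ℝ) ≠ 0 := by positivity
        have : (j : ℝ) ≠ 0 := by positivity
        push_cast at hn' ⊢
        simp only [hi.ne', hj.ne', if_false]
        field_simp
        ring
    rw [sum_congr rfl key, ← mul_sum, sum_add_distrib, sum_sub_distrib, sum_sub_distrib,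
      sum_add_distrib, ← mul_sum, sum_antidiagonal_inv_mul_inv,
      sum_antidiagonal_fst (fun i => 1 / (i : ℝ) ^ 2),
      sum_antidiagonal_snd (fun i => 1 / (i : ℝ) ^ 2),
      sum_antidiagonal_fst (fun i => if i = 0 then 1 / (n : ℝ) ^ 2 else 0),
      sum_antidiagonal_snd (fun i => if i = 0 then 1 / (n : ℝ) ^ 2 else 0)]
    simp only [sum_ite_eq', mem_range, sum_range_succ _ n, hn, hn.ne', if_true, if_false, hG]
    field_simp
    ring
  simp only [hfin] at hprod
  have h := ((hprod.sub htel).add h4).div_const 2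
  have e : ∀ n : ℕ, (2 * (G n * (1 / (n : ℝ) ^ 2)) + 2 * (logSqCoeff n / (n : ℝ) ^ 2) -
      (2 * (G n * (1 / (n : ℝ) ^ 2)) + 1 / (n : ℝ) ^ 4) + 1 / (n : ℝ) ^ 4) / 2 =
      logSqCoeff n / (n : ℝ) ^ 2 := fun n => by ring
  simp only [e] at h
  have e2 : (Real.pi ^ 2 / 6 * (Real.pi ^ 2 / 6) - Real.pi ^ 2 / 6 * (Real.pi ^ 2 / 6) +
      Real.pi ^ 4 / 90) / 2 = Real.pi ^ 4 / 180 := by ring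
  rwa [e2] at h

/-- In H_{2n-1} the even denominators contribute H_{n-1}/2, so the odd ones remain. -/
lemma harm_two_mul (n : ℕ) :
    harm (2 * n) - harm n / 2 = ∑ j ∈ range n, 1 / (2 * (j : ℝ) + 1) := by
  induction n with
  | zero => simp [harm]
  | succ n ih =>
    rw [sum_range_succ, ← ih]
    have e : 2 * (n + 1) = 2 * n + 1 + 1 := by ring
    simp only [harm, e, sum_range_succ]
    push_cast
    rcases Nat.eq_zero_or_pos n with rfl | hn
    · simp
    · field_simp; ring

/-- Each term is (aₖ - aₖ₊ₙ)/(2n) with aⱼ = 1/(2j + 1), so the series telescopes with step n. -/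
lemma hasSum_inv_odd_mul_inv_odd {n : ℕ} (hn : 0 < n) :
    HasSum (fun k : ℕ => 1 / ((2 * (k : ℝ) + 1) * (2 * k + 2 * n + 1)))
      ((∑ j ∈ range n, 1 / (2 * (j : ℝ) + 1)) / (2 * n)) := by
  set a : ℕ → ℝ := fun j => 1 / (2 * (j : ℝ) + 1) with ha
  have hn' : (n : ℝ) ≠ 0 := by positivity
  have ha0 : Tendsto a atTop (𝓝 0) := by
    have h1 : Tendsto (fun j : ℕ => 2 * (j : ℝ) + 1) atTop atTop :=
      tendsto_atTop_add_const_right _ _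
        (tendsto_natCast_atTop_atTop.const_mul_atTop (by norm_num))
    simpa only [ha, one_div] using! h1.inv_tendsto_atTop
  refine hasSum_of_telescope
    (u := fun m => (∑ j ∈ range n, a j - ∑ j ∈ range n, a (j + m)) / (2 * n))
    (fun k => by positivity) (fun m => ?_) ?_
  · induction m with
    | zero => simp
    | succ m ih =>
      rw [sum_range_succ, ih]
      have h1 : ∑ j ∈ range n, a (j + (m + 1)) = ∑ j ∈ range n, a (j + m) + a (n + m) - a m := by
        have h := sum_range_succ (fun j => a (j + m)) n
        rw [sum_range_succ' (fun j => a (j + m)) n] at h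
        simp only [zero_add] at h
        have e : ∀ j, a (j + (m + 1)) = a (j + 1 + m) := fun j => by congr 1; ring
        simp only [e]
        linarith
      rw [h1]
      simp only [ha]
      push_cast
      field_simp
      ring
  · have h : Tendsto (fun m => ∑ j ∈ range n, a (j + m)) atTop (𝓝 (∑ j ∈ range n, (0:ℝ))) :=
      tendsto_finsetSum _ fun j _ => by
        have := ha0.comp (tendsto_add_atTop_nat j)
        simpa [Function.comp_def, add_comm] using this
    simpa using (tendsto_const_nhds.sub h).div_const (2 * (n : ℝ))

lemma hasSum_logSqCoeff {z : ℂ} (hz : ‖z‖ < 1) :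
    HasSum (fun n : ℕ => (logSqCoeff n : ℂ) * z ^ n) (Complex.log (1 - z) ^ 2) := by
  have h := Complex.hasSum_taylorSeries_neg_log hz
  have hs : Summable fun n : ℕ => ‖z ^ n / (n : ℂ)‖ := h.summable.norm
  have := (summable_norm_sum_mul_antidiagonal_of_summable_norm hs hs).of_norm.hasSum
  rw [← tsum_mul_tsum_eq_tsum_sum_antidiagonal_of_summable_norm hs hs, h.tsum_eq] at this
  have e : (fun n : ℕ => (logSqCoeff n : ℂ) * z ^ n) = fun n : ℕ =>
      ∑ kl ∈ HasAntidiagonal.antidiagonal n, z ^ kl.1 / (kl.1 : ℂ) * (z ^ kl.2 / (kl.2 : ℂ)) := by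
    funext n
    rw [← sum_antidiagonal_inv_mul_inv, Complex.ofReal_sum, sum_mul]
    refine sum_congr rfl fun p hp => ?_
    rw [← HasAntidiagonal.mem_antidiagonal.1 hp]
    push_cast
    ring
  rw [e, sq, ← neg_mul_neg]
  exact this

lemma hasSum_logSqCoeff_real {x : ℝ} (hx : |x| < 1) :
    HasSum (fun n : ℕ => logSqCoeff n * x ^ n) (Real.log (1 - x) ^ 2) := by
  have h := hasSum_logSqCoeff (z := (x : ℂ)) (by simpa using hx)
  rw [← Complex.hasSum_ofReal]
  convert h using 1
  · push_cast; rfl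
  · have : 0 ≤ 1 - x := by linarith [(abs_lt.1 hx).2]
    rw [Complex.ofReal_pow, Complex.ofReal_log this]
    push_cast; rfl

end LogSqCoeff

/-! ### Logarithmic integrals on [1/2, 1] -/

section LogIntegrals

open Filter Topology MeasureTheory Real Set intervalIntegral

lemma intervalIntegrable_of_abs_le {f : ℝ → ℝ} (hf : Measurable f) {a b M : ℝ} (hab : a ≤ b)
    (h : ∀ x ∈ Ioo a b, |f x| ≤ M) : IntervalIntegrable f volume a b := by
  rw [intervalIntegrable_iff_integrableOn_Ioo_of_le hab]
  refine Measure.integrableOn_of_bounded (M := M) (by simp) hf.aestronglyMeasurable ?_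
  filter_upwards [self_mem_ae_restrict measurableSet_Ioo] with x hx using h x hx

/-- The linear vanishing of log t at 1 absorbs the singularities of log(1 - t) and 1/(1 - t), which
keeps the integrands below bounded on (1/2, 1). -/
lemma abs_log_le_two_mul_one_sub {t : ℝ} (h : t ∈ Ioo (1 / 2 : ℝ) 1) :
    |log t| ≤ 2 * (1 - t) := by
  obtain ⟨h1, h2⟩ := h
  have h0 : 0 < t := by linarith
  have := one_sub_inv_le_log_of_pos h0
  rw [abs_of_nonpos (log_nonpos h0.le h2.le)]
  have : t⁻¹ - 1 ≤ 2 * (1 - t) := by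
    rw [show t⁻¹ - 1 = (1 - t) * t⁻¹ by field_simp, mul_comm]
    have : t⁻¹ ≤ 2 := by rw [inv_le_comm₀ h0 (by norm_num)]; linarith
    nlinarith
  linarith

lemma mul_log_sq_le {u : ℝ} (h0 : 0 < u) (h1 : u ≤ 1) : u * log u ^ 2 ≤ 4 := by
  have h := abs_log_mul_self_rpow_lt u (1 / 2) h0 h1 (by norm_num)
  have e : (log u * u ^ (1 / 2 : ℝ)) ^ 2 = u * log u ^ 2 := by
    rw [mul_pow, ← rpow_natCast (u ^ (1 / 2 : ℝ)), ← rpow_mul h0.le]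
    norm_num; ring
  rw [← e, ← sq_abs]
  have := abs_nonneg (log u * u ^ (1 / 2 : ℝ))
  rw [show (1 : ℝ) / (1 / 2) = 2 by norm_num] at h
  nlinarith

lemma tendsto_log_mul_log_one_sub :
    Tendsto (fun t : ℝ => log t * log (1 - t)) (𝓝[<] 1) (𝓝 0) := by
  have hc : Tendsto (fun t : ℝ => 2 * |(1 - t) * log (1 - t)|) (𝓝[<] 1) (𝓝 0) := by
    have h : Continuous fun t : ℝ => 2 * |(1 - t) * log (1 - t)| :=
      ((continuous_mul_log.comp (continuous_const.sub continuous_id)).abs).const_mul 2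
    simpa using (h.tendsto 1).mono_left nhdsWithin_le_nhds
  refine squeeze_zero_norm' ?_ hc
  filter_upwards [Ioo_mem_nhdsLT (show (1 / 2 : ℝ) < 1 by norm_num)] with t ht
  rw [norm_mul, norm_eq_abs, norm_eq_abs, abs_mul, ← mul_assoc, abs_of_pos (sub_pos.2 ht.2)]
  exact mul_le_mul_of_nonneg_right (abs_log_le_two_mul_one_sub ht) (abs_nonneg _)

lemma measurable_log_one_sub : Measurable fun t : ℝ => log (1 - t) :=
  measurable_log.comp (measurable_const.sub measurable_id)

section Bounds

variable {t : ℝ}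

lemma abs_log_mul_log_one_sub_le (ht : t ∈ Ioo (1 / 2 : ℝ) 1) : |log t * log (1 - t)| ≤ 2 := by
  have h1 := abs_log_le_two_mul_one_sub ht
  have h2 := abs_log_mul_self_lt (1 - t) (by linarith [ht.2]) (by linarith [ht.1])
  rw [abs_mul, abs_of_pos (sub_pos.2 ht.2)] at h2
  rw [abs_mul]
  nlinarith [abs_nonneg (log (1 - t))]

lemma abs_log_le_one (ht : t ∈ Ioo (1 / 2 : ℝ) 1) : |log t| ≤ 1 := by
  linarith [abs_log_le_two_mul_one_sub ht, ht.1]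

lemma abs_log_div_one_sub_le (ht : t ∈ Ioo (1 / 2 : ℝ) 1) : |log t / (1 - t)| ≤ 2 := by
  rw [abs_div, abs_of_pos (sub_pos.2 ht.2), div_le_iff₀ (sub_pos.2 ht.2)]
  exact abs_log_le_two_mul_one_sub ht

lemma abs_inv_le_two (ht : t ∈ Ioo (1 / 2 : ℝ) 1) : |t⁻¹| ≤ 2 := by
  have h0 : 0 < t := by linarith [ht.1]
  rw [abs_of_pos (inv_pos.2 h0), inv_le_comm₀ h0 (by norm_num)]
  linarith [ht.1]

lemma abs_log_mul_log_one_sub_sq_le (ht : t ∈ Ioo (1 / 2 : ℝ) 1) :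
    |log t * log (1 - t) ^ 2| ≤ 8 := by
  have h1 := abs_log_le_two_mul_one_sub ht
  have h2 := mul_log_sq_le (u := 1 - t) (by linarith [ht.2]) (by linarith [ht.1])
  rw [abs_mul, abs_of_nonneg (sq_nonneg (log (1 - t)))]
  nlinarith [sq_nonneg (log (1 - t))]

end Bounds

lemma intervalIntegrable_log_sq_mul_log_one_sub_div_one_sub :
    IntervalIntegrable (fun t => log t ^ 2 * log (1 - t) / (1 - t)) volume (1 / 2) 1 := by
  refine intervalIntegrable_of_abs_le (M := 2 * 2) ?_ (by norm_num) fun t ht => ?_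
  · exact ((measurable_log.pow_const 2).mul measurable_log_one_sub).div
      (measurable_const.sub measurable_id)
  · rw [show log t ^ 2 * log (1 - t) / (1 - t) = (log t * log (1 - t)) * (log t / (1 - t)) by ring,
      abs_mul]
    exact mul_le_mul (abs_log_mul_log_one_sub_le ht) (abs_log_div_one_sub_le ht)
      (abs_nonneg _) (by norm_num)

lemma intervalIntegrable_log_mul_log_one_sub_sq_div :
    IntervalIntegrable (fun t => log t * log (1 - t) ^ 2 / t) volume (1 / 2) 1 := by
  refine intervalIntegrable_of_abs_le (M := 8 * 2) ?_ (by norm_num) fun t ht => ?_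
  · exact (measurable_log.mul (measurable_log_one_sub.pow_const 2)).div measurable_id
  · rw [div_eq_mul_inv, abs_mul]
    exact mul_le_mul (abs_log_mul_log_one_sub_sq_le ht) (abs_inv_le_two ht)
      (abs_nonneg _) (by norm_num)

lemma intervalIntegrable_log_sq_mul_log_one_sub_div :
    IntervalIntegrable (fun t => log t ^ 2 * log (1 - t) / t) volume (1 / 2) 1 := by
  refine intervalIntegrable_of_abs_le (M := 1 * 2 * 2) ?_ (by norm_num) fun t ht => ?_
  · exact ((measurable_log.pow_const 2).mul measurable_log_one_sub).div measurable_id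
  · rw [show log t ^ 2 * log (1 - t) / t = log t * (log t * log (1 - t)) * t⁻¹ by ring,
      abs_mul, abs_mul (log t)]
    exact mul_le_mul (mul_le_mul (abs_log_le_one ht) (abs_log_mul_log_one_sub_le ht)
      (abs_nonneg _) (by norm_num)) (abs_inv_le_two ht) (abs_nonneg _) (by norm_num)

lemma intervalIntegrable_log_cube_div_one_sub :
    IntervalIntegrable (fun t => log t ^ 3 / (1 - t)) volume (1 / 2) 1 := by
  refine intervalIntegrable_of_abs_le (M := 1 * 1 * 2) ?_ (by norm_num) fun t ht => ?_
  · exact (measurable_log.pow_const 3).div (measurable_const.sub measurable_id)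
  · rw [show log t ^ 3 / (1 - t) = log t * log t * (log t / (1 - t)) by ring,
      abs_mul, abs_mul (log t)]
    exact mul_le_mul (mul_le_mul (abs_log_le_one ht) (abs_log_le_one ht)
      (abs_nonneg _) (by norm_num)) (abs_log_div_one_sub_le ht) (abs_nonneg _) (by norm_num)

lemma intervalIntegrable_log_cube_div :
    IntervalIntegrable (fun t => log t ^ 3 / t) volume (1 / 2) 1 := by
  refine intervalIntegrable_of_abs_le (M := 1 * 1 * 1 * 2) ?_ (by norm_num) fun t ht => ?_
  · exact (measurable_log.pow_const 3).div measurable_id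
  · have h := abs_log_le_one ht
    rw [show log t ^ 3 / t = log t * log t * log t * t⁻¹ by ring, abs_mul, abs_mul, abs_mul]
    exact mul_le_mul (mul_le_mul (mul_le_mul h h (abs_nonneg _) (by norm_num)) h
      (abs_nonneg _) (by norm_num)) (abs_inv_le_two ht) (abs_nonneg _) (by norm_num)

lemma hasDerivAt_log_one_sub {t : ℝ} (ht : t < 1) :
    HasDerivAt (fun t : ℝ => log (1 - t)) (-1 / (1 - t)) t := by
  have h := ((hasDerivAt_id t).const_sub 1).log (by simpa using (sub_pos.2 ht).ne')
  simpa using h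

lemma log_one_half : log (1 / 2 : ℝ) = -log 2 := by
  rw [one_div, log_inv]

/-- Integration by parts with (log t · log(1 - t))²/2, which tends to 0 at 1; at 1/2 both logarithms
are -log 2. -/
lemma integral_log_mul_log_one_sub_sq_div :
    ∫ t in (1 / 2 : ℝ)..1, log t * log (1 - t) ^ 2 / t =
      (∫ t in (1 / 2 : ℝ)..1, log t ^ 2 * log (1 - t) / (1 - t)) - log 2 ^ 4 / 2 := by
  have h := integral_eq_sub_of_hasDerivAt_of_tendsto (a := 1 / 2) (b := 1)
    (f := fun t => (log t * log (1 - t)) ^ 2 / 2)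
    (f' := fun t => log t * log (1 - t) ^ 2 / t - log t ^ 2 * log (1 - t) / (1 - t))
    (fa := log 2 ^ 4 / 2) (fb := 0) (by norm_num) ?_
    (intervalIntegrable_log_mul_log_one_sub_sq_div.sub
      intervalIntegrable_log_sq_mul_log_one_sub_div_one_sub) ?_ ?_
  · rw [integral_sub intervalIntegrable_log_mul_log_one_sub_sq_div
      intervalIntegrable_log_sq_mul_log_one_sub_div_one_sub] at h
    linarith
  · intro t ht
    have h0 : t ≠ 0 := by linarith [ht.1]
    have h1 : 1 - t ≠ 0 := by linarith [ht.2]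
    convert! ((((hasDerivAt_log h0).mul (hasDerivAt_log_one_sub ht.2)).pow 2).div_const 2) using 1
    simp only [Pi.mul_apply]
    field_simp
    ring
  · have hc : ContinuousAt (fun t : ℝ => (log t * log (1 - t)) ^ 2 / 2) (1 / 2) :=
      (((continuousAt_log (by norm_num)).mul
        (hasDerivAt_log_one_sub (by norm_num)).continuousAt).pow 2).div_const 2
    have h := hc.tendsto.mono_left (nhdsWithin_le_nhds (s := Ioi (1 / 2)))
    convert! h using 2
    norm_num [log_one_half]
    ring
  · simpa using (tendsto_log_mul_log_one_sub.pow 2).div_const 2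

/-- Integration by parts with log³ t · log(1 - t), grouped so that the limit 0 at 1 is visible. -/
lemma integral_log_cube_div_one_sub :
    ∫ t in (1 / 2 : ℝ)..1, log t ^ 3 / (1 - t) =
      3 * (∫ t in (1 / 2 : ℝ)..1, log t ^ 2 * log (1 - t) / t) + log 2 ^ 4 := by
  have h := integral_eq_sub_of_hasDerivAt_of_tendsto (a := 1 / 2) (b := 1)
    (f := fun t => log t ^ 2 * (log t * log (1 - t)))
    (f' := fun t => 3 * (log t ^ 2 * log (1 - t) / t) - log t ^ 3 / (1 - t))
    (fa := log 2 ^ 4) (fb := 0) (by norm_num) ?_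
    ((intervalIntegrable_log_sq_mul_log_one_sub_div.const_mul 3).sub
      intervalIntegrable_log_cube_div_one_sub) ?_ ?_
  · rw [integral_sub (intervalIntegrable_log_sq_mul_log_one_sub_div.const_mul 3)
      intervalIntegrable_log_cube_div_one_sub, intervalIntegral.integral_const_mul] at h
    linarith
  · intro t ht
    have h0 : t ≠ 0 := by linarith [ht.1]
    have h1 : 1 - t ≠ 0 := by linarith [ht.2]
    convert! ((hasDerivAt_log h0).pow 2).mul
      ((hasDerivAt_log h0).mul (hasDerivAt_log_one_sub ht.2)) using 1
    simp only [Pi.mul_apply, Pi.pow_apply]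
    field_simp
    ring
  · have hc : ContinuousAt (fun t : ℝ => log t ^ 2 * (log t * log (1 - t))) (1 / 2) :=
      ((continuousAt_log (by norm_num)).pow 2).mul ((continuousAt_log (by norm_num)).mul
        (hasDerivAt_log_one_sub (by norm_num)).continuousAt)
    have h := hc.tendsto.mono_left (nhdsWithin_le_nhds (s := Ioi (1 / 2)))
    convert! h using 2
    norm_num [log_one_half]
    ring
  · have hl : Tendsto log (𝓝[<] 1) (𝓝 0) := by
      simpa using (continuousAt_log (one_ne_zero)).tendsto.mono_left
        (nhdsWithin_le_nhds (s := Iio 1))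
    simpa using (hl.pow 2).mul tendsto_log_mul_log_one_sub

lemma integral_log_cube_div : ∫ t in (1 / 2 : ℝ)..1, log t ^ 3 / t = -(log 2 ^ 4 / 4) := by
  rw [integral_eq_sub_of_hasDerivAt (f := fun t => log t ^ 4 / 4) _
    intervalIntegrable_log_cube_div]
  · rw [log_one_half]; simp; ring
  · intro t ht
    rw [uIcc_of_le (by norm_num)] at ht
    have h0 : t ≠ 0 := by linarith [ht.1]
    convert! ((hasDerivAt_log h0).pow 4).div_const 4 using 1
    field_simp
    ring

/-- Substitution `x = 1 / t - 1`. -/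
lemma integral_log_one_add_sq_mul_log_div :
    ∫ x in (0 : ℝ)..1, log (1 + x) ^ 2 * log x / x =
      (∫ t in (1 / 2 : ℝ)..1, log t ^ 2 * log (1 - t) / t)
      + (∫ t in (1 / 2 : ℝ)..1, log t ^ 2 * log (1 - t) / (1 - t))
      - (∫ t in (1 / 2 : ℝ)..1, log t ^ 3 / t) - ∫ t in (1 / 2 : ℝ)..1, log t ^ 3 / (1 - t) := by
  rw [← integral_add intervalIntegrable_log_sq_mul_log_one_sub_div
      intervalIntegrable_log_sq_mul_log_one_sub_div_one_sub,
    ← integral_sub (intervalIntegrable_log_sq_mul_log_one_sub_div.add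
      intervalIntegrable_log_sq_mul_log_one_sub_div_one_sub) intervalIntegrable_log_cube_div,
    ← integral_sub ((intervalIntegrable_log_sq_mul_log_one_sub_div.add
      intervalIntegrable_log_sq_mul_log_one_sub_div_one_sub).sub intervalIntegrable_log_cube_div)
      intervalIntegrable_log_cube_div_one_sub,
    integral_of_le zero_le_one, integral_of_le (by norm_num), integral_Ioc_eq_integral_Ioo,
    integral_Ioc_eq_integral_Ioo]
  have himg : (fun t : ℝ => t⁻¹ - 1) '' Ioo (1 / 2) 1 = Ioo 0 1 := by
    ext x
    constructor
    · rintro ⟨t, ⟨h1, h2⟩, rfl⟩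
      have h0 : 0 < t := by linarith
      have a1 : 1 < t⁻¹ := (one_lt_inv₀ h0).2 h2
      have a2 : t⁻¹ < 2 := by rw [inv_lt_comm₀ h0 (by norm_num)]; linarith
      constructor <;> dsimp only <;> linarith
    · rintro ⟨h1, h2⟩
      refine ⟨(1 + x)⁻¹, ⟨?_, ?_⟩, by simp⟩
      · rw [one_div]; exact inv_strictAnti₀ (by linarith) (by linarith)
      · exact inv_lt_one_of_one_lt₀ (by linarith)
  rw [← himg, integral_image_eq_integral_abs_deriv_smul measurableSet_Ioo
    (f' := fun t => -(t ^ 2)⁻¹)]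
  -- Here log(1 + x) = -log t, log x = log(1 - t) - log t and |dx|/x = (1/t + 1/(1 - t)) |dt|,
  -- whence four integrals.
  · refine setIntegral_congr_fun measurableSet_Ioo fun t ht => ?_
    have h0 : 0 < t := by linarith [ht.1]
    have h1 : 0 < 1 - t := by linarith [ht.2]
    have e : t⁻¹ - 1 = (1 - t) / t := by field_simp
    rw [abs_neg, abs_of_pos (by positivity), add_sub_cancel, log_inv, e,
      log_div h1.ne' h0.ne', smul_eq_mul]
    field_simp
    ring
  · intro t ht
    have h0 : t ≠ 0 := by linarith [ht.1]
    exact ((hasDerivAt_inv h0).sub_const 1).hasDerivWithinAt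
  · intro s _ t _ h
    simpa using h

end LogIntegrals

/-! ### The alternating Euler sum -/

section AlternatingEulerSum

open Filter Topology MeasureTheory Real Set intervalIntegral

lemma continuous_pow_mul_log {n : ℕ} (hn : 0 < n) : Continuous fun x : ℝ => x ^ n * log x := by
  have : (fun x : ℝ => x ^ n * log x) = fun x => x ^ (n - 1) * (x * log x) := by
    funext x
    rw [← mul_assoc, ← pow_succ, Nat.sub_add_cancel hn]
  rw [this]
  exact (continuous_pow _).mul continuous_mul_log

lemma intervalIntegrable_pow_mul_log (n : ℕ) :
    IntervalIntegrable (fun x : ℝ => x ^ n * log x) volume 0 1 :=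
  intervalIntegrable_log'.continuousOn_mul (continuous_pow n).continuousOn

lemma integral_pow_mul_log (n : ℕ) :
    ∫ x in (0 : ℝ)..1, x ^ n * log x = -(1 / ((n : ℝ) + 1) ^ 2) := by
  have hn : ((n : ℝ) + 1) ≠ 0 := by positivity
  rw [integral_eq_sub_of_hasDerivAt_of_le zero_le_one
    (f := fun x : ℝ => x ^ (n + 1) * log x / (n + 1) - x ^ (n + 1) / ((n : ℝ) + 1) ^ 2)
    (((continuous_pow_mul_log n.succ_pos).div_const _).sub
      ((continuous_pow _).div_const _)).continuousOn _ (intervalIntegrable_pow_mul_log n)]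
  · simp
  · intro x hx
    have hx0 : x ≠ 0 := hx.1.ne'
    convert! ((((hasDerivAt_pow (n + 1) x).mul (hasDerivAt_log hx0)).div_const ((n : ℝ) + 1)).sub
      ((hasDerivAt_pow (n + 1) x).div_const (((n : ℝ) + 1) ^ 2))) using 1
    push_cast
    field_simp
    ring

/-- Termwise integration of `∑ cₙ sⁿ xⁿ⁻¹ log x`, where `cₙ` are the coefficients of
`log² (1 - x)`. -/
lemma hasSum_integral_log_one_sub_mul_sq {s : ℝ} (hs : |s| = 1) :
    HasSum (fun n : ℕ => -(s ^ n * (logSqCoeff n / (n : ℝ) ^ 2)))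
      (∫ x in (0 : ℝ)..1, log (1 - s * x) ^ 2 * log x / x) := by
  -- The truncated exponent n - 1 is harmless at n = 0 because `logSqCoeff 0 = 0`.
  have hpos : ∀ n : ℕ, ∀ x ∈ Ioo (0 : ℝ) 1,
      logSqCoeff n * (s * x) ^ n * (log x / x) =
      logSqCoeff n * s ^ n * (x ^ (n - 1) * log x) := by
    intro n x hx
    have hx0 : x ≠ 0 := hx.1.ne'
    rcases n with _ | n
    · simp [logSqCoeff]
    · rw [Nat.add_sub_cancel, mul_pow, pow_succ x]
      field_simp
  have hint : ∀ n : ℕ, IntegrableOn (fun x : ℝ => x ^ (n - 1) * log x) (Ioo 0 1) := fun n =>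
    (intervalIntegrable_iff_integrableOn_Ioo_of_le zero_le_one).1
      (intervalIntegrable_pow_mul_log (n - 1))
  have hval : ∀ n : ℕ, logSqCoeff n * ∫ x in Ioo (0 : ℝ) 1, x ^ (n - 1) * log x =
      -(logSqCoeff n / (n : ℝ) ^ 2) := by
    intro n
    rw [← integral_Ioc_eq_integral_Ioo, ← integral_of_le zero_le_one, integral_pow_mul_log]
    rcases n with _ | n
    · simp [logSqCoeff]
    · rw [Nat.add_sub_cancel]; push_cast; ring
  have h := hasSum_integral_of_summable_integral_norm (μ := volume.restrict (Ioo (0 : ℝ) 1))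
    (F := fun n x => logSqCoeff n * s ^ n * (x ^ (n - 1) * log x))
    (fun n => (hint n).const_mul _) ?_
  · rw [integral_of_le zero_le_one, integral_Ioc_eq_integral_Ioo]
    convert! h using 1
    · funext n
      rw [MeasureTheory.integral_const_mul, mul_right_comm, hval]
      ring
    · refine setIntegral_congr_fun measurableSet_Ioo fun x hx => ?_
      have h1 : |s * x| < 1 := by
        rw [abs_mul, hs, one_mul, abs_of_pos hx.1]; exact hx.2
      have h2 := (hasSum_logSqCoeff_real h1).mul_right (log x / x)
      rw [← tsum_congr fun n => hpos n x hx, h2.tsum_eq]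
      ring
  -- As |s| = 1 and log x has constant sign, the L¹ norms are exactly cₙ/n².
  · convert hasSum_logSqCoeff_div_sq.summable using 1
    funext n
    have e : ∀ x ∈ Ioo (0 : ℝ) 1, ‖logSqCoeff n * s ^ n * (x ^ (n - 1) * log x)‖ =
        logSqCoeff n * -(x ^ (n - 1) * log x) := by
      intro x hx
      rw [norm_mul, norm_mul, norm_pow, norm_eq_abs s, hs, one_pow, mul_one,
        norm_of_nonneg (logSqCoeff_nonneg n), norm_of_nonpos]
      exact mul_nonpos_of_nonneg_of_nonpos (pow_nonneg hx.1.le _) (log_nonpos hx.1.le hx.2.le)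
    rw [setIntegral_congr_fun measurableSet_Ioo e, MeasureTheory.integral_const_mul,
      MeasureTheory.integral_neg, mul_neg, hval, neg_neg]

lemma integral_log_one_sub_sq_mul_log_div :
    ∫ x in (0 : ℝ)..1, log (1 - x) ^ 2 * log x / x = -(π ^ 4 / 180) := by
  have h := hasSum_integral_log_one_sub_mul_sq (s := 1) (by simp)
  simp only [one_pow, one_mul] at h
  exact h.unique hasSum_logSqCoeff_div_sq.neg

/-- Split ∫₀¹ log²(1 - x) log x / x = -π⁴/180 at 1/2. The reflection x ↦ 1 - x makes the lower half
equal to this integral; integration by parts makes the upper half equal to it minus log⁴ 2 / 2. -/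
lemma integral_log_sq_mul_log_one_sub_div_one_sub :
    ∫ t in (1 / 2 : ℝ)..1, log t ^ 2 * log (1 - t) / (1 - t) = log 2 ^ 4 / 4 - π ^ 4 / 360 := by
  have hsw : ∫ x in (0 : ℝ)..(1 / 2), log (1 - x) ^ 2 * log x / x =
      ∫ t in (1 / 2 : ℝ)..1, log t ^ 2 * log (1 - t) / (1 - t) := by
    have h := integral_comp_sub_left (a := (1 / 2 : ℝ)) (b := 1)
      (fun x : ℝ => log (1 - x) ^ 2 * log x / x) 1
    norm_num at h ⊢
    exact h.symm
  have hi : IntervalIntegrable (fun x : ℝ => log (1 - x) ^ 2 * log x / x) volume 0 (1 / 2) := by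
    have h := intervalIntegrable_log_sq_mul_log_one_sub_div_one_sub.comp_sub_left 1
    norm_num at h ⊢
    exact h.symm
  have h2 := integral_log_mul_log_one_sub_sq_div
  have h3 := intervalIntegrable_log_mul_log_one_sub_sq_div
  simp only [mul_comm (log _) (log (1 - _) ^ 2)] at h2 h3
  have h := integral_add_adjacent_intervals hi h3
  rw [integral_log_one_sub_sq_mul_log_div, hsw, h2] at h
  linarith

/-- For k > 0 the added term at n = 0 is 1/0 = 0. -/
lemma hasSum_polyLog {k : ℕ} (hk : 0 < k) {x : ℝ} (hx : |x| < 1) :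
    HasSum (fun n : ℕ => x ^ n / (n : ℝ) ^ k) (polyLog k x) := by
  rw [← hasSum_nat_add_iff' 1]
  simp only [Finset.range_one, Finset.sum_singleton, Nat.cast_zero, zero_pow hk.ne', div_zero,
    sub_zero, Nat.cast_add, Nat.cast_one]
  refine Summable.hasSum (Summable.of_norm_bounded
    (g := fun m : ℕ => |x| ^ (m + 1)) ?_ fun m => ?_)
  · exact (summable_nat_add_iff 1).2 (summable_geometric_of_lt_one (abs_nonneg x) hx)
  · rw [norm_div, norm_pow, norm_eq_abs]
    refine div_le_self (by positivity) ?_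
    rw [norm_of_nonneg (by positivity)]
    exact one_le_pow₀ (by linarith [(Nat.cast_nonneg m : (0 : ℝ) ≤ m)])

lemma kummerLambda_four_one_half :
    kummerLambda 4 (1 / 2) = 2 * polyLog 4 (1 / 2) + 2 * log 2 * polyLog 3 (1 / 2)
      + log 2 ^ 2 * polyLog 2 (1 / 2) + log 2 ^ 4 / 4 := by
  simp only [kummerLambda, Finset.sum_range_succ, Finset.sum_range_zero]
  rw [abs_of_pos (by norm_num), log_one_half]
  norm_num [Nat.factorial]
  ring

lemma integral_pow_mul_log_sq {n : ℕ} (hn : 0 < n) :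
    ∫ t in (1 / 2 : ℝ)..1, t ^ n / n * (log t ^ 2 / t) =
      2 * (1 / (n : ℝ) ^ 4) - (log 2 ^ 2 * ((1 / 2) ^ n / (n : ℝ) ^ 2)
        + 2 * log 2 * ((1 / 2) ^ n / (n : ℝ) ^ 3) + 2 * ((1 / 2) ^ n / (n : ℝ) ^ 4)) := by
  have hn' : (n : ℝ) ≠ 0 := by positivity
  have h0 : ∀ t ∈ uIcc (1 / 2 : ℝ) 1, t ≠ 0 := by
    intro t ht
    rw [uIcc_of_le (by norm_num)] at ht
    linarith [ht.1]
  rw [integral_eq_sub_of_hasDerivAt (f := fun t : ℝ =>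
    t ^ n * (log t ^ 2 / (n : ℝ) ^ 2 - 2 * log t / (n : ℝ) ^ 3 + 2 / (n : ℝ) ^ 4))]
  · simp only [log_one_half, log_one]
    field_simp
    ring
  · intro t ht
    have ht0 := h0 t ht
    have hl := hasDerivAt_log ht0
    convert! (hasDerivAt_pow n t).mul ((((hl.pow 2).div_const ((n : ℝ) ^ 2)).sub
      ((hl.const_mul 2).div_const ((n : ℝ) ^ 3))).add_const (2 / (n : ℝ) ^ 4)) using 1
    obtain ⟨m, rfl⟩ : ∃ m, n = m + 1 := ⟨n - 1, by omega⟩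
    simp only [Nat.add_sub_cancel, Pi.sub_apply, Pi.pow_apply]
    field_simp
    ring
  · refine ContinuousOn.intervalIntegrable ?_
    have hl : ContinuousOn log (uIcc (1 / 2 : ℝ) 1) := fun t ht =>
      (continuousAt_log (h0 t ht)).continuousWithinAt
    exact ((continuous_pow n).continuousOn.div_const _).mul ((hl.pow 2).div continuousOn_id h0)

/-- Expand -log(1 - t) and integrate termwise. The endpoint 1 yields 2ζ(4) = π⁴/45; the endpoint 1/2
yields Li₂, Li₃, Li₄ with exactly the weights they have in λ₄(1/2). -/
lemma integral_log_sq_mul_log_one_sub_div :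
    ∫ t in (1 / 2 : ℝ)..1, log t ^ 2 * log (1 - t) / t =
      kummerLambda 4 (1 / 2) - π ^ 4 / 45 - log 2 ^ 4 / 4 := by
  have hx : |(1 / 2 : ℝ)| < 1 := by rw [abs_of_pos] <;> norm_num
  have hsum := (hasSum_zeta_four.mul_left 2).sub ((((hasSum_polyLog two_pos hx).mul_left
    (log 2 ^ 2)).add ((hasSum_polyLog three_pos hx).mul_left (2 * log 2))).add
      ((hasSum_polyLog four_pos hx).mul_left 2))
  have hval : ∀ n : ℕ, ∫ t in Ioo (1 / 2 : ℝ) 1, t ^ n / n * (log t ^ 2 / t) =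
      2 * (1 / (n : ℝ) ^ 4) - (log 2 ^ 2 * ((1 / 2) ^ n / (n : ℝ) ^ 2)
        + 2 * log 2 * ((1 / 2) ^ n / (n : ℝ) ^ 3) + 2 * ((1 / 2) ^ n / (n : ℝ) ^ 4)) := by
    intro n
    rcases Nat.eq_zero_or_pos n with rfl | hn
    · simp
    · rw [← integral_pow_mul_log_sq hn, integral_of_le (by norm_num), integral_Ioc_eq_integral_Ioo]
  have hnn : ∀ n : ℕ, ∀ t ∈ Ioo (1 / 2 : ℝ) 1, 0 ≤ t ^ n / n * (log t ^ 2 / t) := by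
    intro n t ht
    have : 0 < t := by linarith [ht.1]
    positivity
  have h := hasSum_integral_of_summable_integral_norm (μ := volume.restrict (Ioo (1 / 2 : ℝ) 1))
    (F := fun (n : ℕ) t => t ^ n / n * (log t ^ 2 / t)) (fun n => ?_) ?_
  · simp only [hval] at h
    have hu := h.unique hsum
    rw [kummerLambda_four_one_half]
    have e : ∫ t in (1 / 2 : ℝ)..1, log t ^ 2 * log (1 - t) / t =
        - ∫ t in Ioo (1 / 2 : ℝ) 1, ∑' n : ℕ, t ^ n / (n : ℝ) * (log t ^ 2 / t) := by
      rw [integral_of_le (by norm_num), integral_Ioc_eq_integral_Ioo, ← MeasureTheory.integral_neg]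
      refine setIntegral_congr_fun measurableSet_Ioo fun t ht => ?_
      have ht0 : 0 < t := by linarith [ht.1]
      have ht1 : ‖(t : ℂ)‖ < 1 := by
        rw [Complex.norm_real, norm_of_nonneg ht0.le]; exact ht.2
      have hs : HasSum (fun n : ℕ => t ^ n / (n : ℝ)) (-log (1 - t)) := by
        have := Complex.hasSum_taylorSeries_neg_log ht1
        rw [← Complex.hasSum_ofReal]
        convert! this using 1
        · push_cast; rfl
        · rw [Complex.ofReal_neg, Complex.ofReal_log (by linarith [ht.2])]
          push_cast; rfl
      rw [(hs.mul_right (log t ^ 2 / t)).tsum_eq]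
      ring
    rw [e, hu]
    ring
  · refine (intervalIntegrable_iff_integrableOn_Ioo_of_le (by norm_num)).1 ?_
    refine ContinuousOn.intervalIntegrable ?_
    have h0 : ∀ t ∈ uIcc (1 / 2 : ℝ) 1, t ≠ 0 := by
      intro t ht
      rw [uIcc_of_le (by norm_num)] at ht
      linarith [ht.1]
    have hl : ContinuousOn log (uIcc (1 / 2 : ℝ) 1) := fun t ht =>
      (continuousAt_log (h0 t ht)).continuousWithinAt
    exact ((continuous_pow n).continuousOn.div_const _).mul ((hl.pow 2).div continuousOn_id h0)
  · refine hsum.summable.congr fun n => ?_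
    rw [← hval n]
    exact (setIntegral_congr_fun measurableSet_Ioo fun t ht => norm_of_nonneg (hnn n t ht)).symm

/-- The alternating Euler sum `∑ (-1)ⁿ 2 H_{n-1} / n³`. -/
lemma hasSum_neg_one_pow_mul_logSqCoeff_div_sq :
    HasSum (fun n : ℕ => (-1) ^ n * (logSqCoeff n / (n : ℝ) ^ 2))
      (2 * kummerLambda 4 (1 / 2) - π ^ 4 / 24) := by
  have h := (hasSum_integral_log_one_sub_mul_sq (s := -1) (by simp)).neg
  simp only [neg_neg, neg_one_mul, sub_neg_eq_add] at h
  convert! h using 1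
  rw [integral_log_one_add_sq_mul_log_div, integral_log_sq_mul_log_one_sub_div_one_sub,
    integral_log_cube_div_one_sub, integral_log_cube_div, integral_log_sq_mul_log_one_sub_div]
  ring

end AlternatingEulerSum

/-! ### The log-sine integral of weight four -/

section LogSineIntegral

open Filter Topology MeasureTheory Real Set intervalIntegral

lemma abs_log_le_one_sub_log {s y : ℝ} (hs0 : 0 < s) (hs1 : s ≤ 1) (h1 : s ≤ y) (h2 : y ≤ 2) :
    |log y| ≤ 1 - log s := by
  have a1 := log_le_log hs0 h1
  have a2 := log_le_log (hs0.trans_le h1) h2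
  have a3 := log_nonpos hs0.le hs1
  have a4 : log 2 ≤ 1 := by linarith [log_two_lt_d9]
  rw [abs_le]
  constructor <;> linarith

/-- From (C - log s)² ≤ 2C² + 2 log² s and s log² s ≤ 4. -/
lemma mul_sq_sub_log_le {C s : ℝ} (hs0 : 0 < s) (hs1 : s ≤ 1) :
    s * (C - log s) ^ 2 ≤ 2 * C ^ 2 + 8 := by
  have h := mul_log_sq_le hs0 hs1
  nlinarith [mul_nonneg hs0.le (sq_nonneg (C + log s)), sq_nonneg C]

lemma two_div_pi_mul_mem {u : ℝ} (hu : u ∈ Ioc 0 (π / 2)) :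
    0 < 2 / π * u ∧ 2 / π * u ≤ 1 ∧ 2 / π * u ≤ sin u := by
  have hp := pi_pos
  refine ⟨mul_pos (by positivity) hu.1, ?_, mul_le_sin hu.1.le hu.2⟩
  exact (mul_le_sin hu.1.le hu.2).trans (sin_le_one u)

lemma mul_sq_le_of_abs_le {C u y : ℝ} (hu : u ∈ Ioc 0 (π / 2)) (hy0 : 0 ≤ y)
    (hy : y ≤ C - log (2 / π * u)) : u * y ^ 2 ≤ π / 2 * (2 * C ^ 2 + 8) := by
  obtain ⟨h0, h1, -⟩ := two_div_pi_mul_mem hu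
  have hp := pi_pos
  calc u * y ^ 2 = π / 2 * (2 / π * u * y ^ 2) := by field_simp
    _ ≤ π / 2 * (2 / π * u * (C - log (2 / π * u)) ^ 2) := by gcongr
    _ ≤ _ := by gcongr; exact mul_sq_sub_log_le h0 h1

lemma intervalIntegrable_mul_log_two_sin_sq :
    IntervalIntegrable (fun u => u * log (2 * sin u) ^ 2) volume 0 (π / 2) := by
  refine intervalIntegrable_of_abs_le (M := π / 2 * (2 * 1 ^ 2 + 8)) (by fun_prop)
    (by positivity) fun u hu => ?_
  have hu' := Ioo_subset_Ioc_self hu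
  obtain ⟨h0, h1, h2⟩ := two_div_pi_mul_mem hu'
  rw [abs_of_nonneg (mul_nonneg hu.1.le (sq_nonneg _)), ← sq_abs]
  refine mul_sq_le_of_abs_le hu' (abs_nonneg _) (abs_log_le_one_sub_log h0 h1 ?_ ?_)
  · linarith
  · linarith [sin_le_one u]

lemma integral_mul_cos_two_mul (n : ℕ) :
    ∫ u in (0 : ℝ)..(π / 2), logSqCoeff n * (u * cos (2 * n * u)) =
      logSqCoeff n * (((-1) ^ n - 1) / (4 * (n : ℝ) ^ 2)) := by
  rcases Nat.eq_zero_or_pos n with rfl | hn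
  · simp [logSqCoeff]
  have hn' : (n : ℝ) ≠ 0 := by positivity
  rw [intervalIntegral.integral_const_mul, integral_eq_sub_of_hasDerivAt (f := fun u =>
    u * sin (2 * n * u) / (2 * n) + cos (2 * n * u) / (4 * (n : ℝ) ^ 2))]
  · rw [show 2 * (n : ℝ) * (π / 2) = n * π by ring, sin_nat_mul_pi, cos_nat_mul_pi]
    simp
    left
    ring
  · intro u _
    have hl : HasDerivAt (fun u : ℝ => 2 * (n : ℝ) * u) (2 * n) u := by
      simpa using (hasDerivAt_id u).const_mul (2 * (n : ℝ))
    convert! (((hasDerivAt_id u).mul hl.sin).div_const (2 * (n : ℝ))).add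
      (hl.cos.div_const (4 * (n : ℝ) ^ 2)) using 1
    simp only [id]
    field_simp
    ring
  · exact Continuous.intervalIntegrable (by fun_prop) _ _

lemma norm_mul_exp_two_mul {r : ℝ} (hr : 0 ≤ r) (u : ℝ) :
    ‖(r : ℂ) * Complex.exp (2 * u * Complex.I)‖ = r := by
  rw [norm_mul, Complex.norm_real, norm_of_nonneg hr]
  have := Complex.norm_exp_ofReal_mul_I (2 * u)
  push_cast at this
  rw [this, mul_one]

lemma re_logSqCoeff_mul_pow (r u : ℝ) (n : ℕ) :
    ((logSqCoeff n : ℂ) * ((r : ℂ) * Complex.exp (2 * u * Complex.I)) ^ n).re =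
      logSqCoeff n * r ^ n * cos (2 * n * u) := by
  rw [mul_pow, ← Complex.exp_nat_mul, ← mul_assoc, ← Complex.ofReal_pow, ← Complex.ofReal_mul,
    Complex.re_ofReal_mul, show (n : ℂ) * (2 * u * Complex.I) = ((2 * n * u : ℝ) : ℂ) * Complex.I by
      push_cast; ring, Complex.exp_ofReal_mul_I_re]

lemma hasSum_integral_re_log_sq {r : ℝ} (hr0 : 0 ≤ r) (hr1 : r < 1) :
    HasSum (fun n : ℕ => r ^ n * (logSqCoeff n * (((-1) ^ n - 1) / (4 * (n : ℝ) ^ 2))))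
      (∫ u in (0 : ℝ)..(π / 2),
        u * (Complex.log (1 - r * Complex.exp (2 * u * Complex.I)) ^ 2).re) := by
  have hs := (hasSum_logSqCoeff_real (x := r) (by rwa [abs_of_nonneg hr0])).summable
  have h := intervalIntegral.hasSum_integral_of_dominated_convergence (a := 0) (b := π / 2)
    (μ := volume)
    (F := fun (n : ℕ) u => r ^ n * (logSqCoeff n * (u * cos (2 * n * u))))
    (f := fun u => u * (Complex.log (1 - r * Complex.exp (2 * u * Complex.I)) ^ 2).re)
    (fun n _ => π / 2 * (logSqCoeff n * r ^ n)) (fun n => ?_) (fun n => ?_) ?_ ?_ ?_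
  · simpa only [intervalIntegral.integral_const_mul (r ^ _), integral_mul_cos_two_mul] using h
  · exact Continuous.aestronglyMeasurable (by fun_prop)
  · refine ae_of_all _ fun u hu => ?_
    rw [uIoc_of_le (by positivity)] at hu
    have h1 : |cos (2 * n * u)| ≤ 1 := abs_cos_le_one _
    have hc := logSqCoeff_nonneg n
    rw [norm_mul, norm_mul, norm_mul, norm_eq_abs (cos _), norm_of_nonneg hc,
      norm_of_nonneg hu.1.le, norm_of_nonneg (pow_nonneg hr0 n)]
    calc r ^ n * (logSqCoeff n * (u * |cos (2 * n * u)|))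
        ≤ r ^ n * (logSqCoeff n * (π / 2 * 1)) := by
          have := hu.1.le
          gcongr
          exact hu.2
      _ = _ := by ring
  · exact ae_of_all _ fun u _ => hs.mul_left _
  · exact intervalIntegrable_const
  · refine ae_of_all _ fun u _ => ?_
    have h1 : ‖(r : ℂ) * Complex.exp (2 * u * Complex.I)‖ < 1 := by
      rwa [norm_mul_exp_two_mul hr0]
    have h2 := (Complex.hasSum_re (hasSum_logSqCoeff h1)).mul_left u
    simp only [re_logSqCoeff_mul_pow] at h2
    convert! h2 using 2
    ring

/-- The squared norm is (1 - r)² + 4r sin² u, and 4r ≥ 1. Being uniform in r, the bound provides the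
domination as r → 1. -/
lemma sin_le_norm_one_sub {r u : ℝ} (hr : 1 / 4 ≤ r) :
    sin u ≤ ‖1 - (r : ℂ) * Complex.exp (2 * u * Complex.I)‖ := by
  refine le_of_sq_le_sq ?_ (norm_nonneg _)
  rw [← Complex.normSq_eq_norm_sq, Complex.normSq_apply]
  have e : (2 : ℂ) * u * Complex.I = ((2 * u : ℝ) : ℂ) * Complex.I := by push_cast; ring
  rw [Complex.sub_re, Complex.sub_im, Complex.re_ofReal_mul, Complex.im_ofReal_mul, e,
    Complex.exp_ofReal_mul_I_re, Complex.exp_ofReal_mul_I_im, Complex.one_re, Complex.one_im,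
    cos_two_mul, sin_two_mul]
  have h := sin_sq_add_cos_sq u
  have h2 : (1 - r * (2 * cos u ^ 2 - 1)) * (1 - r * (2 * cos u ^ 2 - 1)) +
      (0 - r * (2 * sin u * cos u)) * (0 - r * (2 * sin u * cos u)) =
      (1 - r) ^ 2 + 4 * r * sin u ^ 2 := by
    rw [show cos u ^ 2 = 1 - sin u ^ 2 by linarith,
      show (0 - r * (2 * sin u * cos u)) * (0 - r * (2 * sin u * cos u)) =
        4 * r ^ 2 * sin u ^ 2 * cos u ^ 2 by ring, show cos u ^ 2 = 1 - sin u ^ 2 by linarith]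
    ring
  rw [h2]
  nlinarith [sq_nonneg (sin u), sq_nonneg (1 - r)]

lemma norm_one_sub_mul_exp_le_two {r : ℝ} (hr0 : 0 ≤ r) (hr1 : r ≤ 1) (u : ℝ) :
    ‖1 - (r : ℂ) * Complex.exp (2 * u * Complex.I)‖ ≤ 2 := by
  refine (norm_sub_le _ _).trans ?_
  rw [norm_mul_exp_two_mul hr0, norm_one]
  linarith

/-- 1 - e^{2iu} = 2 sin u · e^{i(u - π/2)}, and u - π/2 lies in (-π, π], so this is the principal
logarithm. -/
lemma log_one_sub_exp_two_mul {u : ℝ} (hu : u ∈ Ioc 0 (π / 2)) :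
    Complex.log (1 - Complex.exp (2 * u * Complex.I)) =
      ((log (2 * sin u) : ℝ) : ℂ) + ((u - π / 2 : ℝ) : ℂ) * Complex.I := by
  have hp := pi_pos
  have hs : 0 < sin u := sin_pos_of_pos_of_lt_pi hu.1 (by linarith [hu.2])
  have e : (1 - Complex.exp (2 * u * Complex.I)) =
      Complex.exp (((log (2 * sin u) : ℝ) : ℂ) + ((u - π / 2 : ℝ) : ℂ) * Complex.I) := by
    rw [Complex.exp_add, ← Complex.ofReal_exp, exp_log (by positivity)]
    apply Complex.ext
    · rw [Complex.re_ofReal_mul, Complex.exp_ofReal_mul_I_re, cos_sub_pi_div_two, Complex.sub_re,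
        show (2 : ℂ) * u * Complex.I = ((2 * u : ℝ) : ℂ) * Complex.I by push_cast; ring,
        Complex.exp_ofReal_mul_I_re, cos_two_mul, Complex.one_re]
      linarith [sin_sq_add_cos_sq u]
    · rw [Complex.im_ofReal_mul, Complex.exp_ofReal_mul_I_im, sin_sub_pi_div_two, Complex.sub_im,
        show (2 : ℂ) * u * Complex.I = ((2 * u : ℝ) : ℂ) * Complex.I by push_cast; ring,
        Complex.exp_ofReal_mul_I_im, sin_two_mul, Complex.one_im]
      ring
  rw [e, Complex.log_exp]
  · simp
    linarith [hu.1]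
  · simp
    linarith [hu.2]

/-- Dominated convergence by a constant: |log w| ≤ 1 + π - log(2u/π), and the weight u absorbs the
squared logarithm. -/
lemma tendsto_integral_re_log_sq :
    Tendsto (fun r : ℝ => ∫ u in (0 : ℝ)..(π / 2),
        u * (Complex.log (1 - r * Complex.exp (2 * u * Complex.I)) ^ 2).re) (𝓝[<] 1)
      (𝓝 (∫ u in (0 : ℝ)..(π / 2), u * (log (2 * sin u) ^ 2 - (u - π / 2) ^ 2))) := by
  have hp := pi_pos
  have hr : ∀ᶠ r : ℝ in 𝓝[<] 1, r ∈ Ioo (1 / 4 : ℝ) 1 := Ioo_mem_nhdsLT (by norm_num)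
  refine intervalIntegral.tendsto_integral_filter_of_dominated_convergence
    (fun _ => π / 2 * (2 * (1 + π) ^ 2 + 8)) ?_ ?_ ?_ ?_
  · refine Eventually.of_forall fun r => Measurable.aestronglyMeasurable ?_
    fun_prop
  · filter_upwards [hr] with r hr
    refine ae_of_all _ fun u hu => ?_
    rw [uIoc_of_le (by positivity)] at hu
    obtain ⟨h0, h1, h2⟩ := two_div_pi_mul_mem hu
    set w := 1 - (r : ℂ) * Complex.exp (2 * u * Complex.I) with hw
    have hn : ‖Complex.log w‖ ≤ (1 + π) - log (2 / π * u) := by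
      refine (Complex.norm_le_abs_re_add_abs_im _).trans ?_
      have h3 := abs_log_le_one_sub_log h0 h1 (h2.trans (sin_le_norm_one_sub hr.1.le))
        (norm_one_sub_mul_exp_le_two (by linarith [hr.1]) hr.2.le u)
      have h4 := Complex.abs_arg_le_pi w
      rw [Complex.log_re, Complex.log_im]
      linarith
    rw [norm_mul, norm_of_nonneg hu.1.le, norm_eq_abs]
    refine le_trans (mul_le_mul_of_nonneg_left ((Complex.abs_re_le_norm _).trans_eq (norm_pow _ _))
      hu.1.le) (mul_sq_le_of_abs_le hu (norm_nonneg _) hn)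
  · exact intervalIntegrable_const
  · refine ae_of_all _ fun u hu => ?_
    rw [uIoc_of_le (by positivity)] at hu
    have hs : 0 < sin u := sin_pos_of_pos_of_lt_pi hu.1 (by linarith [hu.2])
    have hre : (log (2 * sin u) ^ 2 - (u - π / 2) ^ 2) =
        (Complex.log (1 - (1 : ℝ) * Complex.exp (2 * u * Complex.I)) ^ 2).re := by
      rw [Complex.ofReal_one, one_mul, log_one_sub_exp_two_mul hu, sq (_ + _), Complex.mul_re]
      simp
      ring
    rw [hre]
    refine Tendsto.mono_left (ContinuousAt.tendsto (f := fun r : ℝ =>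
      u * (Complex.log (1 - r * Complex.exp (2 * u * Complex.I)) ^ 2).re) (x := 1) ?_)
      nhdsWithin_le_nhds
    have hc : ContinuousAt (fun r : ℝ => 1 - (r : ℂ) * Complex.exp (2 * u * Complex.I)) 1 := by
      fun_prop
    refine continuousAt_const.mul (Complex.continuous_re.continuousAt.comp
      ((hc.clog ?_).pow 2))
    left
    rw [Complex.ofReal_one, one_mul, Complex.sub_re,
      show (2 : ℂ) * u * Complex.I = ((2 * u : ℝ) : ℂ) * Complex.I by push_cast; ring,
      Complex.exp_ofReal_mul_I_re, cos_two_mul, Complex.one_re]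
    nlinarith [sin_sq_add_cos_sq u]

lemma integral_mul_sub_sq :
    ∫ u in (0 : ℝ)..(π / 2), u * (u - π / 2) ^ 2 = π ^ 4 / 192 := by
  rw [integral_eq_sub_of_hasDerivAt
    (f := fun u => u ^ 4 / 4 - π * u ^ 3 / 3 + π ^ 2 * u ^ 2 / 8)]
  · ring
  · intro u _
    convert! (((hasDerivAt_pow 4 u).div_const 4).sub
      (((hasDerivAt_pow 3 u).const_mul π).div_const 3)).add
      (((hasDerivAt_pow 2 u).const_mul (π ^ 2)).div_const 8) using 1
    norm_num
    ring
  · exact Continuous.intervalIntegrable (by fun_prop) _ _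

/-- A log-sine integral of weight four. -/
lemma integral_mul_log_two_sin_sq :
    ∫ u in (0 : ℝ)..(π / 2), u * log (2 * sin u) ^ 2 =
      π ^ 4 / 192 + (2 * kummerLambda 4 (1 / 2) - π ^ 4 / 24 - π ^ 4 / 180) / 4 := by
  have hsum : HasSum (fun n : ℕ => logSqCoeff n * (((-1) ^ n - 1) / (4 * (n : ℝ) ^ 2)))
      ((2 * kummerLambda 4 (1 / 2) - π ^ 4 / 24 - π ^ 4 / 180) / 4) := by
    convert! (hasSum_neg_one_pow_mul_logSqCoeff_div_sq.sub
      hasSum_logSqCoeff_div_sq).div_const 4 using 1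
    funext n
    ring
  have hr : ∀ᶠ r : ℝ in 𝓝[<] 1, r ∈ Ioo (0 : ℝ) 1 := Ioo_mem_nhdsLT (by norm_num)
  -- Abel summation: the series converges absolutely at r = 1, so it can be compared there with the
  -- limit of the integrals.
  have h1 : Tendsto (fun r : ℝ => ∑' n : ℕ,
      r ^ n * (logSqCoeff n * (((-1) ^ n - 1) / (4 * (n : ℝ) ^ 2)))) (𝓝[<] 1)
      (𝓝 (∑' n : ℕ, logSqCoeff n * (((-1) ^ n - 1) / (4 * (n : ℝ) ^ 2)))) := by
    refine tendsto_tsum_of_dominated_convergence hsum.summable.norm (fun n => ?_) ?_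
    · have hc : Continuous fun r : ℝ =>
          r ^ n * (logSqCoeff n * (((-1) ^ n - 1) / (4 * (n : ℝ) ^ 2))) := by fun_prop
      simpa using (hc.tendsto 1).mono_left nhdsWithin_le_nhds
    · filter_upwards [hr] with r hr n
      rw [norm_mul, norm_pow, norm_of_nonneg hr.1.le]
      exact mul_le_of_le_one_left (norm_nonneg _) (pow_le_one₀ hr.1.le hr.2.le)
  have h2 := tendsto_integral_re_log_sq.congr' (f₂ := fun r : ℝ => ∑' n : ℕ,
      r ^ n * (logSqCoeff n * (((-1) ^ n - 1) / (4 * (n : ℝ) ^ 2)))) (by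
    filter_upwards [hr] with r hr
    exact (hasSum_integral_re_log_sq hr.1.le hr.2).tsum_eq.symm)
  have h3 := tendsto_nhds_unique h2 h1
  rw [hsum.tsum_eq] at h3
  simp only [mul_sub] at h3
  rw [integral_sub intervalIntegrable_mul_log_two_sin_sq
    (Continuous.intervalIntegrable (by fun_prop) _ _), integral_mul_sub_sq] at h3
  linarith

end LogSineIntegral

/-! ### The mean of log² |a + by| over the circle -/

section CircleIntegral

open Filter Topology MeasureTheory Real Set intervalIntegral

lemma integral_cos_int_mul {k : ℤ} (hk : k ≠ 0) :
    ∫ t in (0 : ℝ)..1, cos (k * (2 * π * t)) = 0 := by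
  have hk' : (k : ℝ) ≠ 0 := by exact_mod_cast hk
  have hp := pi_pos
  rw [integral_eq_sub_of_hasDerivAt (f := fun t => sin (k * (2 * π * t)) / (k * (2 * π)))]
  · have : sin (k * (2 * π * 1)) = 0 := by
      rw [show (k : ℝ) * (2 * π * 1) = ((2 * k : ℤ) : ℝ) * π by push_cast; ring, sin_int_mul_pi]
    simp only [this]
    simp
  · intro t _
    have hl : HasDerivAt (fun t : ℝ => k * (2 * π * t)) (k * (2 * π)) t := by
      simpa using ((hasDerivAt_id t).const_mul (2 * π)).const_mul (k : ℝ)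
    convert! hl.sin.div_const (k * (2 * π)) using 1
    field_simp
  · exact Continuous.intervalIntegrable (by fun_prop) _ _

lemma integral_cos_nat_mul_mul_cos_nat_mul {n : ℕ} (hn : 0 < n) (m : ℕ) :
    ∫ t in (0 : ℝ)..1, cos (n * (2 * π * t)) * cos (m * (2 * π * t)) =
      if m = n then 1 / 2 else 0 := by
  have e : ∀ t : ℝ, cos (n * (2 * π * t)) * cos (m * (2 * π * t)) =
      (1 / 2) * cos (((n + m : ℕ) : ℤ) * (2 * π * t))
        + (1 / 2) * cos (((n : ℤ) - m : ℤ) * (2 * π * t)) := by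
    intro t
    push_cast
    rw [add_mul, sub_mul, cos_add, cos_sub]
    ring
  simp only [e]
  rw [integral_add (Continuous.intervalIntegrable (by fun_prop) _ _)
    (Continuous.intervalIntegrable (by fun_prop) _ _), intervalIntegral.integral_const_mul,
    intervalIntegral.integral_const_mul, integral_cos_int_mul (by omega)]
  split_ifs with h
  · subst h; simp
  · rw [integral_cos_int_mul (by omega)]; simp

/-- `log |1 + r e^{2πit}|`, for real `r`. -/
noncomputable def logNormCircle (r t : ℝ) : ℝ :=
  log ‖1 + (r : ℂ) * Complex.exp (2 * π * Complex.I * t)‖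

lemma exp_two_pi_mul_I (t : ℝ) :
    Complex.exp (2 * π * Complex.I * t) = Complex.exp ((2 * π * t : ℝ) * Complex.I) := by
  push_cast; congr 1; ring

lemma norm_exp_two_pi_mul_I (t : ℝ) : ‖Complex.exp (2 * π * Complex.I * t)‖ = 1 := by
  rw [exp_two_pi_mul_I, Complex.norm_exp_ofReal_mul_I]

variable {r : ℝ}

lemma one_add_mul_exp_ne_zero (hr0 : 0 ≤ r) (hr1 : r < 1) (t : ℝ) :
    1 + (r : ℂ) * Complex.exp (2 * π * Complex.I * t) ≠ 0 := by
  intro h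
  have h2 := congrArg norm (eq_neg_of_add_eq_zero_left h)
  rw [norm_neg, norm_mul, norm_exp_two_pi_mul_I, Complex.norm_real, norm_of_nonneg hr0] at h2
  norm_num at h2
  linarith

lemma continuous_logNormCircle (hr0 : 0 ≤ r) (hr1 : r < 1) : Continuous (logNormCircle r) := by
  refine Continuous.log (by fun_prop) fun t => ?_
  exact norm_ne_zero_iff.2 (one_add_mul_exp_ne_zero hr0 hr1 t)

/-- The real part of the series of log(1 - z) at z = -r e^{2πit}. -/
lemma hasSum_logNormCircle (hr0 : 0 ≤ r) (hr1 : r < 1) (t : ℝ) :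
    HasSum (fun n : ℕ => -((-r) ^ n / n) * cos (n * (2 * π * t))) (logNormCircle r t) := by
  set z : ℂ := -((r : ℂ) * Complex.exp (2 * π * Complex.I * t)) with hz
  have hn : ‖z‖ < 1 := by
    rw [hz, norm_neg, norm_mul, norm_exp_two_pi_mul_I, Complex.norm_real, norm_of_nonneg hr0]
    linarith
  have h := (Complex.hasSum_re (Complex.hasSum_taylorSeries_neg_log hn)).neg
  rw [Complex.neg_re, neg_neg, Complex.log_re, hz, sub_neg_eq_add] at h
  convert! h using 1
  funext n
  rw [← neg_mul, mul_pow, exp_two_pi_mul_I, ← Complex.exp_nat_mul, mul_div_right_comm,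
    show (n : ℂ) * (((2 * π * t : ℝ) : ℂ) * Complex.I) =
      ((n * (2 * π * t) : ℝ) : ℂ) * Complex.I by push_cast; ring,
    show (-(r : ℂ)) ^ n / n = (((-r) ^ n / n : ℝ) : ℂ) by push_cast; ring,
    Complex.re_ofReal_mul, Complex.exp_ofReal_mul_I_re, neg_mul]

lemma abs_neg_pow_div_mul_cos_le (hr0 : 0 ≤ r) (n : ℕ) (x : ℝ) :
    |(-((-r) ^ n / n) * cos x)| ≤ r ^ n := by
  have h1 : |cos x| ≤ 1 := abs_cos_le_one x
  rw [abs_mul, abs_neg, abs_div, abs_pow, abs_neg, abs_of_nonneg hr0, Nat.abs_cast]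
  have h2 : r ^ n / n ≤ r ^ n := by
    rcases Nat.eq_zero_or_pos n with rfl | hn
    · simp
    · exact div_le_self (by positivity) (by exact_mod_cast hn)
  calc r ^ n / n * |cos x| ≤ r ^ n * 1 := by gcongr
    _ = r ^ n := mul_one _

lemma integral_cos_mul_logNormCircle (hr0 : 0 ≤ r) (hr1 : r < 1) {n : ℕ} (hn : 0 < n) :
    ∫ t in (0 : ℝ)..1, cos (n * (2 * π * t)) * logNormCircle r t =
      -((-r) ^ n / n) / 2 := by
  have h := intervalIntegral.hasSum_integral_of_dominated_convergence (a := 0) (b := 1)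
    (μ := volume)
    (F := fun (m : ℕ) t => -((-r) ^ m / m) * (cos (n * (2 * π * t)) * cos (m * (2 * π * t))))
    (f := fun t => cos (n * (2 * π * t)) * logNormCircle r t)
    (fun m _ => r ^ m) (fun m => ?_) (fun m => ?_) ?_ ?_ ?_
  · simp only [intervalIntegral.integral_const_mul, integral_cos_nat_mul_mul_cos_nat_mul hn] at h
    have h2 := hasSum_ite_eq n (-((-r) ^ n / n) / 2)
    refine h.unique ?_
    convert! h2 using 1
    funext m
    split_ifs with hm
    · subst hm; ring
    · simp
  · exact Continuous.aestronglyMeasurable (by fun_prop)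
  · refine ae_of_all _ fun t _ => ?_
    rw [norm_eq_abs, mul_left_comm, abs_mul]
    exact (mul_le_of_le_one_left (abs_nonneg _) (abs_cos_le_one _)).trans
      (abs_neg_pow_div_mul_cos_le hr0 m _)
  · exact ae_of_all _ fun t _ => summable_geometric_of_lt_one hr0 hr1
  · exact intervalIntegrable_const
  · refine ae_of_all _ fun t _ => ?_
    have h2 := (hasSum_logNormCircle hr0 hr1 t).mul_left (cos (n * (2 * π * t)))
    convert! h2 using 2
    ring

lemma integral_logNormCircle (hr0 : 0 ≤ r) (hr1 : r < 1) :
    ∫ t in (0 : ℝ)..1, logNormCircle r t = 0 := by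
  have h := intervalIntegral.hasSum_integral_of_dominated_convergence (a := 0) (b := 1)
    (μ := volume)
    (F := fun (m : ℕ) t => -((-r) ^ m / m) * cos (m * (2 * π * t)))
    (f := logNormCircle r)
    (fun m _ => r ^ m) (fun m => ?_) (fun m => ?_) ?_ ?_ ?_
  · refine h.unique ?_
    convert! hasSum_zero using 1
    funext m
    rw [intervalIntegral.integral_const_mul]
    rcases Nat.eq_zero_or_pos m with rfl | hm
    · simp
    · have := integral_cos_int_mul (k := m) (by omega)
      push_cast at this
      rw [this, mul_zero]
  · exact Continuous.aestronglyMeasurable (by fun_prop)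
  · exact ae_of_all _ fun t _ => abs_neg_pow_div_mul_cos_le hr0 m _
  · exact ae_of_all _ fun t _ => summable_geometric_of_lt_one hr0 hr1
  · exact intervalIntegrable_const
  · exact ae_of_all _ fun t _ => hasSum_logNormCircle hr0 hr1 t

/-- Parseval's identity for `log |1 + r e^{2πit}|`. -/
lemma integral_logNormCircle_sq (hr0 : 0 ≤ r) (hr1 : r < 1) :
    ∫ t in (0 : ℝ)..1, logNormCircle r t ^ 2 = polyLog 2 (r ^ 2) / 2 := by
  have hcont := continuous_logNormCircle hr0 hr1
  -- Only one factor is expanded; each term then integrates to a known Fourier coefficient of the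
  -- other.
  have h := intervalIntegral.hasSum_integral_of_dominated_convergence (a := 0) (b := 1)
    (μ := volume)
    (F := fun (m : ℕ) t => -((-r) ^ m / m) * (cos (m * (2 * π * t)) * logNormCircle r t))
    (f := fun t => logNormCircle r t ^ 2)
    (fun m t => r ^ m * |logNormCircle r t|) (fun m => ?_) (fun m => ?_) ?_ ?_ ?_
  · have hx : |r ^ 2| < 1 := by
      rw [abs_of_nonneg (sq_nonneg r)]; nlinarith
    refine h.unique ?_
    convert! (hasSum_polyLog two_pos hx).div_const 2 using 1
    funext m
    rw [intervalIntegral.integral_const_mul]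
    rcases Nat.eq_zero_or_pos m with rfl | hm
    · simp
    · rw [integral_cos_mul_logNormCircle hr0 hr1 hm]
      have : ((-r) ^ m) * ((-r) ^ m) = (r ^ 2) ^ m := by rw [← mul_pow]; congr 1; ring
      field_simp
      rw [← this]; ring
  · exact Continuous.aestronglyMeasurable (by fun_prop)
  · refine ae_of_all _ fun t _ => ?_
    rw [← mul_assoc, norm_mul, norm_eq_abs, norm_eq_abs]
    exact mul_le_mul_of_nonneg_right (abs_neg_pow_div_mul_cos_le hr0 m _) (abs_nonneg _)
  · exact ae_of_all _ fun t _ => (summable_geometric_of_lt_one hr0 hr1).mul_right _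
  · simp only [tsum_mul_right]
    exact Continuous.intervalIntegrable (by fun_prop) _ _
  · refine ae_of_all _ fun t _ => ?_
    have h2 := (hasSum_logNormCircle hr0 hr1 t).mul_right (logNormCircle r t)
    rw [← sq] at h2
    convert! h2 using 2
    ring

/-- The mean of `log² |A + B e^{2πit}|` over the circle, for `0 < B < A`. -/
lemma lintegral_log_norm_add_mul_exp_sq {A B : ℝ} (hB : 0 < B) (hBA : B < A) :
    ∫⁻ t in Ioc (0 : ℝ) 1,
      ENNReal.ofReal (log ‖(A : ℂ) + B * Complex.exp (2 * π * Complex.I * t)‖ ^ 2) =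
      ENNReal.ofReal (log A ^ 2) + ENNReal.ofReal (polyLog 2 ((B / A) ^ 2) / 2) := by
  have hA : 0 < A := hB.trans hBA
  have hr0 : 0 ≤ B / A := by positivity
  have hr1 : B / A < 1 := (div_lt_one hA).2 hBA
  -- With A factored out, the cross term has mean zero and Parseval evaluates the square.
  have e : ∀ t : ℝ, log ‖(A : ℂ) + B * Complex.exp (2 * π * Complex.I * t)‖ ^ 2 =
      log A ^ 2 + 2 * log A * logNormCircle (B / A) t + logNormCircle (B / A) t ^ 2 := by
    intro t
    have hne := norm_ne_zero_iff.2 (one_add_mul_exp_ne_zero hr0 hr1 t)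
    have hA' : (A : ℂ) ≠ 0 := by exact_mod_cast hA.ne'
    have e1 : (A : ℂ) + B * Complex.exp (2 * π * Complex.I * t) =
        A * (1 + ((B / A : ℝ) : ℂ) * Complex.exp (2 * π * Complex.I * t)) := by
      push_cast; field_simp
    rw [e1, norm_mul, Complex.norm_real, norm_of_nonneg hA.le, log_mul hA.ne' hne]
    unfold logNormCircle
    ring
  have hcont := continuous_logNormCircle hr0 hr1
  have hval : ∫ t in (0 : ℝ)..1, (log A ^ 2 + 2 * log A * logNormCircle (B / A) t
      + logNormCircle (B / A) t ^ 2) = log A ^ 2 + polyLog 2 ((B / A) ^ 2) / 2 := by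
    rw [integral_add (Continuous.intervalIntegrable (by fun_prop) _ _)
      (Continuous.intervalIntegrable (by fun_prop) _ _),
      integral_add (Continuous.intervalIntegrable (by fun_prop) _ _)
      (Continuous.intervalIntegrable (by fun_prop) _ _), intervalIntegral.integral_const_mul,
      integral_logNormCircle hr0 hr1, integral_logNormCircle_sq hr0 hr1]
    simp
  have hnn : 0 ≤ polyLog 2 ((B / A) ^ 2) / 2 := by
    rw [← integral_logNormCircle_sq hr0 hr1]
    exact intervalIntegral.integral_nonneg zero_le_one fun _ _ => sq_nonneg _
  rw [← ENNReal.ofReal_add (sq_nonneg _) hnn, ← hval, integral_of_le zero_le_one,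
    ofReal_integral_eq_lintegral_ofReal]
  · simp only [e]
  · exact Continuous.integrableOn_Ioc (by fun_prop)
  · refine ae_of_all _ fun t => ?_
    dsimp only [Pi.zero_apply]
    rw [← e]; positivity

/-- A periodic function has the same integral over each translate of a period. -/
lemma lintegral_Ioc_zero_one_add {f : ℝ → ENNReal} (hf : Function.Periodic f 1) (c : ℝ) :
    ∫⁻ t in Ioc (0 : ℝ) 1, f (c + t) = ∫⁻ t in Ioc (0 : ℝ) 1, f t := by
  have h1 := UnitAddCircle.lintegral_preimage 0 hf.lift
  have h2 := UnitAddCircle.lintegral_preimage c hf.lift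
  simp only [Function.Periodic.lift_coe, zero_add] at h1 h2
  rw [h1, ← h2]
  have hm : MeasurePreserving (fun t : ℝ => c + t) := measurePreserving_add_left volume c
  have h3 := hm.setLIntegral_comp_preimage_emb (measurableEmbedding_addLeft c) f (Ioc c (c + 1))
  rw [← h3]
  congr 2
  ext t
  simp

lemma periodic_exp_two_pi_mul_I :
    Function.Periodic (fun t : ℝ => Complex.exp (2 * π * Complex.I * t)) 1 := by
  intro t
  dsimp only
  push_cast
  rw [mul_add, mul_one, Complex.exp_add, Complex.exp_two_pi_mul_I, mul_one]

lemma exists_eq_norm_mul_exp (a : ℂ) :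
    ∃ c : ℝ, a = ‖a‖ * Complex.exp (2 * π * Complex.I * c) := by
  refine ⟨a.arg / (2 * π), ?_⟩
  rw [exp_two_pi_mul_I, mul_div_cancel₀ _ (by positivity)]
  exact (Complex.norm_mul_exp_arg_mul_I a).symm

/-- The mean of `log² |A + B e^{2πit}|` over the circle, as an extended real. -/
noncomputable def circleMeanLogSq (A B : ℝ) : ENNReal :=
  ∫⁻ t in Ioc (0 : ℝ) 1,
    ENNReal.ofReal (log ‖(A : ℂ) + B * Complex.exp (2 * π * Complex.I * t)‖ ^ 2)

/-- The phase of a factors out of the norm, and the phase of b relative to a is a shift of t. -/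
lemma lintegral_log_norm_eq_circleMeanLogSq (a b : ℂ) :
    ∫⁻ t in Ioc (0 : ℝ) 1,
      ENNReal.ofReal (log ‖a + b * Complex.exp (2 * π * Complex.I * t)‖ ^ 2) =
      circleMeanLogSq ‖a‖ ‖b‖ := by
  obtain ⟨α, hα⟩ := exists_eq_norm_mul_exp a
  obtain ⟨β, hβ⟩ := exists_eq_norm_mul_exp b
  have hper : Function.Periodic (fun t : ℝ => ENNReal.ofReal
      (log ‖(‖a‖ : ℂ) + ‖b‖ * Complex.exp (2 * π * Complex.I * t)‖ ^ 2)) 1 := by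
    intro t
    have := periodic_exp_two_pi_mul_I t
    dsimp only at this ⊢
    rw [this]
  unfold circleMeanLogSq
  rw [← lintegral_Ioc_zero_one_add hper (β - α)]
  refine lintegral_congr fun t => ?_
  have e : a + b * Complex.exp (2 * π * Complex.I * t) = Complex.exp (2 * π * Complex.I * α) *
      ((‖a‖ : ℂ) + ‖b‖ * Complex.exp (2 * π * Complex.I * ((β - α + t : ℝ) : ℂ))) := by
    have h : Complex.exp (2 * π * Complex.I * β) * Complex.exp (2 * π * Complex.I * t) =
        Complex.exp (2 * π * Complex.I * α) *
          Complex.exp (2 * π * Complex.I * ((β - α + t : ℝ) : ℂ)) := by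
      rw [← Complex.exp_add, ← Complex.exp_add]
      push_cast
      congr 1
      ring
    conv_lhs => rw [hα, hβ]
    linear_combination (‖b‖ : ℂ) * h
  rw [e, norm_mul, norm_exp_two_pi_mul_I, one_mul]

/-- For |ω| = 1, A + Bω is ω times the conjugate of B + Aω. -/
lemma circleMeanLogSq_comm {A B : ℝ} : circleMeanLogSq A B = circleMeanLogSq B A := by
  have hneg : ∀ t : ℝ, ‖(A : ℂ) + B * Complex.exp (2 * π * Complex.I * t)‖ =
      ‖(B : ℂ) + A * Complex.exp (2 * π * Complex.I * t)‖ := by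
    intro t
    have h : (starRingEnd ℂ) ((B : ℂ) + A * Complex.exp (2 * π * Complex.I * t)) *
        Complex.exp (2 * π * Complex.I * t) =
        (A : ℂ) + B * Complex.exp (2 * π * Complex.I * t) := by
      have h1 : (starRingEnd ℂ) (Complex.exp (2 * π * Complex.I * t)) *
          Complex.exp (2 * π * Complex.I * t) = 1 := by
        rw [mul_comm, Complex.mul_conj, Complex.normSq_eq_norm_sq, norm_exp_two_pi_mul_I]
        simp
      rw [map_add, map_mul, Complex.conj_ofReal, Complex.conj_ofReal]
      linear_combination (A : ℂ) * h1
    rw [← h, norm_mul, norm_exp_two_pi_mul_I, mul_one, RCLike.norm_conj]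
  unfold circleMeanLogSq
  simp only [hneg]

lemma measurable_circleMeanLogSq :
    Measurable fun p : ℝ × ℝ => circleMeanLogSq p.1 p.2 := by
  refine Measurable.lintegral_prod_right' (f := fun q : (ℝ × ℝ) × ℝ => ENNReal.ofReal
    (log ‖(q.1.1 : ℂ) + q.1.2 * Complex.exp (2 * π * Complex.I * q.2)‖ ^ 2)) ?_
  fun_prop

end CircleIntegral

/-! ### The dilogarithm of the sine quotient -/

section SineQuotient

open Filter Topology MeasureTheory Real Set intervalIntegral

lemma integral_sin_div_sqrt {r : ℝ} (hr0 : 0 < r) (hr1 : r < 1) :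
    ∫ u in (0 : ℝ)..(π / 2), sin u / √(1 - r ^ 2 * sin u ^ 2) =
      (log (1 + r) - log (1 - r)) / (2 * r) := by
  have hD : ∀ u : ℝ, 0 < 1 - r ^ 2 * sin u ^ 2 := fun u => by
    have h1 := sin_sq_le_one u
    have h2 : r ^ 2 < 1 := by nlinarith
    nlinarith [sq_nonneg r, sq_nonneg (sin u)]
  have hDlt : ∀ u : ℝ, 0 ≤ cos u → 0 < r * cos u + √(1 - r ^ 2 * sin u ^ 2) := fun u hu =>
    add_pos_of_nonneg_of_pos (mul_nonneg hr0.le hu) (sqrt_pos.2 (hD u))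
  -- The logarithm's argument runs from 1 + r at u = 0 to √(1 - r²) at u = π/2, which gives
  -- artanh(r)/r.
  rw [integral_eq_sub_of_hasDerivAt (f := fun u =>
    -(log (r * cos u + √(1 - r ^ 2 * sin u ^ 2)) / r))]
  · have h1 : 1 - r ^ 2 = (1 + r) * (1 - r) := by ring
    simp only [cos_pi_div_two, sin_pi_div_two, cos_zero, sin_zero, mul_zero, zero_add, one_pow,
      mul_one, ne_eq, OfNat.ofNat_ne_zero, not_false_eq_true, zero_pow, sub_zero, sqrt_one]
    rw [log_sqrt (by nlinarith), h1, log_mul (by linarith) (by linarith), add_comm r 1]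
    field_simp
    ring
  · intro u hu
    rw [uIcc_of_le (by positivity)] at hu
    have hs := sqrt_pos.2 (hD u)
    have hc : 0 ≤ cos u := cos_nonneg_of_mem_Icc ⟨by linarith [hu.1, pi_pos], hu.2⟩
    have hp := hDlt u hc
    have h1 : HasDerivAt (fun u => √(1 - r ^ 2 * sin u ^ 2))
        (-(r ^ 2 * (2 * sin u * cos u)) / (2 * √(1 - r ^ 2 * sin u ^ 2))) u := by
      convert! ((((hasDerivAt_sin u).pow 2).const_mul (r ^ 2)).const_sub 1).sqrt (hD u).ne' using 1
      norm_num
    convert! (((((hasDerivAt_cos u).const_mul r).add h1).log hp.ne').div_const r).neg using 1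
    simp only [Pi.add_apply]
    generalize √(1 - r ^ 2 * sin u ^ 2) = D at hs hp ⊢
    have := hp.ne'
    field_simp
    ring
  · refine Continuous.intervalIntegrable ?_ _ _
    exact continuous_sin.div (by fun_prop) fun u => (sqrt_pos.2 (hD u)).ne'

lemma lintegral_sin_div_sqrt {r : ℝ} (hr0 : 0 < r) (hr1 : r < 1) :
    ∫⁻ u in Ioo (0 : ℝ) (π / 2), ENNReal.ofReal (sin u / √(1 - r ^ 2 * sin u ^ 2)) =
      ∑' k : ℕ, ENNReal.ofReal (r ^ (2 * k) / (2 * k + 1)) := by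
  have hs : HasSum (fun k : ℕ => r ^ (2 * k) / (2 * (k : ℝ) + 1))
      ((log (1 + r) - log (1 - r)) / (2 * r)) := by
    have h := (hasSum_log_sub_log_of_abs_lt_one (x := r)
      (by rwa [abs_of_pos hr0])).div_const (2 * r)
    convert! h using 1
    funext k
    rw [pow_succ]
    field_simp
  rw [← ENNReal.ofReal_tsum_of_nonneg (fun k => by positivity) hs.summable, hs.tsum_eq,
    ← integral_sin_div_sqrt hr0 hr1, integral_of_le (by positivity), integral_Ioc_eq_integral_Ioo,
    ofReal_integral_eq_lintegral_ofReal]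
  · have hD : ∀ u : ℝ, 0 < 1 - r ^ 2 * sin u ^ 2 := fun u => by
      have h1 := sin_sq_le_one u
      have h2 : r ^ 2 < 1 := by nlinarith
      nlinarith [sq_nonneg r, sq_nonneg (sin u)]
    have hc : Continuous fun u => sin u / √(1 - r ^ 2 * sin u ^ 2) :=
      continuous_sin.div (by fun_prop) fun u => (sqrt_pos.2 (hD u)).ne'
    exact hc.integrableOn_Icc.mono_set Ioo_subset_Icc_self
  · filter_upwards [self_mem_ae_restrict measurableSet_Ioo] with u hu
    exact div_nonneg (sin_nonneg_of_nonneg_of_le_pi hu.1.le (by linarith [hu.2, pi_pos]))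
      (sqrt_nonneg _)

/-- Substitution `sin v = r sin u`. -/
lemma lintegral_sin_div_sin {u : ℝ} (hu : u ∈ Ioo 0 (π / 2)) (Q : ℝ → ENNReal) :
    ∫⁻ v in Ioo 0 u, Q (sin v / sin u) =
      ∫⁻ r in Ioo (0 : ℝ) 1, ENNReal.ofReal (sin u / √(1 - r ^ 2 * sin u ^ 2)) * Q r := by
  have hs0 : 0 < sin u := sin_pos_of_pos_of_lt_pi hu.1 (by linarith [hu.2, pi_pos])
  have hs1 : sin u ≤ 1 := sin_le_one u
  have hmem : ∀ r ∈ Ioo (0 : ℝ) 1, r * sin u ∈ Ioo (0 : ℝ) 1 := fun r hr =>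
    ⟨mul_pos hr.1 hs0, by nlinarith [hr.1, hr.2]⟩
  have himg : (fun r => arcsin (r * sin u)) '' Ioo (0 : ℝ) 1 = Ioo 0 u := by
    ext v
    constructor
    · rintro ⟨r, hr, rfl⟩
      refine ⟨arcsin_pos.2 (hmem r hr).1, ?_⟩
      rw [arcsin_lt_iff_lt_sin ⟨by linarith [(hmem r hr).1], (hmem r hr).2.le⟩
        ⟨by linarith [hu.1, pi_pos], hu.2.le⟩]
      exact mul_lt_of_lt_one_left hs0 hr.2
    · rintro ⟨h1, h2⟩
      have hlt : sin v < sin u := sin_lt_sin_of_lt_of_le_pi_div_two (by linarith [pi_pos]) hu.2.le h2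
      refine ⟨sin v / sin u, ⟨div_pos (sin_pos_of_pos_of_lt_pi h1
        (by linarith [hu.2, pi_pos])) hs0, (div_lt_one hs0).2 hlt⟩, ?_⟩
      dsimp only
      rw [div_mul_cancel₀ _ hs0.ne', arcsin_sin (by linarith [pi_pos]) (by linarith [hu.2])]
  rw [← himg, lintegral_image_eq_lintegral_abs_deriv_mul measurableSet_Ioo
    (f' := fun r => 1 / √(1 - (r * sin u) ^ 2) * sin u)]
  · refine setLIntegral_congr_fun measurableSet_Ioo fun r hr => ?_
    have h := hmem r hr
    rw [sin_arcsin (by linarith [h.1]) h.2.le, mul_div_cancel_right₀ _ hs0.ne', abs_of_nonneg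
      (by positivity), mul_pow, one_div_mul_eq_div]
  · intro r hr
    have h := hmem r hr
    have h1 : HasDerivAt (fun r : ℝ => r * sin u) (sin u) r := by
      simpa using (hasDerivAt_id r).mul_const (sin u)
    exact ((hasDerivAt_arcsin (by linarith [h.1]) h.2.ne).comp r h1).hasDerivWithinAt
  · intro r hr s hs h
    have h1 := hmem r hr
    have h2 := hmem s hs
    exact mul_right_cancel₀ hs0.ne' (injOn_arcsin ⟨by linarith [h1.1], h1.2.le⟩
      ⟨by linarith [h2.1], h2.2.le⟩ h)

lemma lintegral_pow_Ioo (n : ℕ) {c : ℝ} (hc : 0 ≤ c) :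
    ∫⁻ r in Ioo (0 : ℝ) 1, ENNReal.ofReal (c * r ^ n) = ENNReal.ofReal (c / (n + 1)) := by
  rw [← ofReal_integral_eq_lintegral_ofReal, ← integral_Ioc_eq_integral_Ioo,
    ← integral_of_le zero_le_one, intervalIntegral.integral_const_mul, integral_pow]
  · simp [div_eq_mul_inv]
  · exact (Continuous.integrableOn_Icc (by fun_prop)).mono_set Ioo_subset_Icc_self
  · filter_upwards [self_mem_ae_restrict measurableSet_Ioo] with r hr
    have := hr.1
    positivity

lemma hasSum_even_logSqCoeff :
    HasSum (fun n : ℕ => logSqCoeff (2 * n) / ((2 * n : ℕ) : ℝ) ^ 2)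
      ((π ^ 4 / 180 + (2 * kummerLambda 4 (1 / 2) - π ^ 4 / 24)) / 2) := by
  have h := (hasSum_logSqCoeff_div_sq.add hasSum_neg_one_pow_mul_logSqCoeff_div_sq).div_const 2
  have hinj : Function.Injective fun n : ℕ => 2 * n := fun a b h => by
    dsimp only at h; omega
  have h2 := (hinj.hasSum_iff (f := fun n : ℕ => (logSqCoeff n / (n : ℝ) ^ 2
    + (-1) ^ n * (logSqCoeff n / (n : ℝ) ^ 2)) / 2) fun n hn => ?_).2 h
  · convert! h2 using 1
    funext n
    simp only [Function.comp_apply, pow_mul]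
    norm_num
  · have hodd : Odd n := by
      rw [← Nat.not_even_iff_odd]
      rintro ⟨m, hm⟩
      exact hn ⟨m, by dsimp only; omega⟩
    rw [hodd.neg_one_pow]
    ring

/-- The inner sum is H_{2n-1} - H_{n-1}/2. Its first part gives the even-indexed terms of S₊, its
second 1/16 of all of S₊. -/
lemma hasSum_sum_inv_odd_div_cube :
    HasSum (fun n : ℕ => 1 / (2 * (n : ℝ) ^ 2) *
        ((∑ j ∈ Finset.range n, 1 / (2 * (j : ℝ) + 1)) / (2 * n)))
      ((π ^ 4 / 180 + (2 * kummerLambda 4 (1 / 2) - π ^ 4 / 24)) / 2 - π ^ 4 / 180 / 16) := by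
  convert! hasSum_even_logSqCoeff.sub (hasSum_logSqCoeff_div_sq.div_const 16) using 1
  funext n
  rw [← harm_two_mul]
  rcases Nat.eq_zero_or_pos n with rfl | hn
  · simp [logSqCoeff]
  · unfold logSqCoeff
    push_cast
    field_simp
    ring

/-- After sin v = r sin u and Tonelli, the u-integral is ∑ r^{2k}/(2k + 1). Multiplying by the
dilogarithm series and integrating monomials in r leaves a double sum whose k-part telescopes by
`hasSum_inv_odd_mul_inv_odd`. -/
lemma lintegral_lintegral_polyLog_sin_div_sin :
    ∫⁻ u in Ioo (0 : ℝ) (π / 2), ∫⁻ v in Ioo 0 u,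
      ENNReal.ofReal (polyLog 2 ((sin v / sin u) ^ 2) / 2) =
      ENNReal.ofReal ((π ^ 4 / 180 + (2 * kummerLambda 4 (1 / 2) - π ^ 4 / 24)) / 2
        - π ^ 4 / 180 / 16) := by
  set Q : ℝ → ENNReal := fun r =>
    ∑' n : ℕ, ENNReal.ofReal (1 / (2 * (n : ℝ) ^ 2) * r ^ (2 * n)) with hQ
  have hQm : Measurable Q := by
    refine Measurable.tsum fun n => ?_
    fun_prop
  have hQv : ∀ r ∈ Ioo (0 : ℝ) 1, ENNReal.ofReal (polyLog 2 (r ^ 2) / 2) = Q r := by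
    intro r hr
    have hx : |r ^ 2| < 1 := by
      rw [abs_of_nonneg (sq_nonneg r)]; nlinarith [hr.1, hr.2]
    have h := (hasSum_polyLog two_pos hx).div_const 2
    have e : ∀ n : ℕ, (r ^ 2) ^ n / (n : ℝ) ^ 2 / 2 = 1 / (2 * (n : ℝ) ^ 2) * r ^ (2 * n) := by
      intro n; rw [pow_mul]; ring
    simp only [e] at h
    rw [hQ, ← h.tsum_eq]
    exact ENNReal.ofReal_tsum_of_nonneg (fun n => by have := hr.1; positivity) h.summable
  have step1 : ∀ u ∈ Ioo (0 : ℝ) (π / 2),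
      ∫⁻ v in Ioo 0 u, ENNReal.ofReal (polyLog 2 ((sin v / sin u) ^ 2) / 2) =
      ∫⁻ r in Ioo (0 : ℝ) 1, ENNReal.ofReal (sin u / √(1 - r ^ 2 * sin u ^ 2)) * Q r := by
    intro u hu
    rw [lintegral_sin_div_sin hu (fun r => ENNReal.ofReal (polyLog 2 (r ^ 2) / 2))]
    refine setLIntegral_congr_fun measurableSet_Ioo fun r hr => ?_
    rw [hQv r hr]
  rw [setLIntegral_congr_fun measurableSet_Ioo step1, lintegral_lintegral_swap]
  swap
  · refine Measurable.aemeasurable ?_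
    unfold Function.uncurry
    exact Measurable.mul (by fun_prop) (hQm.comp measurable_snd)
  have step2 : ∀ r ∈ Ioo (0 : ℝ) 1, ∫⁻ u in Ioo (0 : ℝ) (π / 2),
      ENNReal.ofReal (sin u / √(1 - r ^ 2 * sin u ^ 2)) * Q r =
      ∑' n : ℕ, ∑' k : ℕ,
        ENNReal.ofReal (1 / (2 * (n : ℝ) ^ 2 * (2 * k + 1)) * r ^ (2 * k + 2 * n)) := by
    intro r hr
    rw [lintegral_mul_const _ (by fun_prop), lintegral_sin_div_sqrt hr.1 hr.2, mul_comm, hQ,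
      ← ENNReal.tsum_mul_right]
    refine tsum_congr fun n => ?_
    rw [← ENNReal.tsum_mul_left]
    refine tsum_congr fun k => ?_
    have := hr.1
    rw [← ENNReal.ofReal_mul (by positivity), pow_add]
    congr 1
    simp only [div_eq_mul_inv, mul_inv]
    ring
  rw [setLIntegral_congr_fun measurableSet_Ioo step2, lintegral_tsum]
  swap
  · intro n
    exact (Measurable.tsum fun k => by fun_prop).aemeasurable
  have hs := hasSum_sum_inv_odd_div_cube
  rw [← hs.tsum_eq, ENNReal.ofReal_tsum_of_nonneg (fun n => mul_nonneg (by positivity)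
    (div_nonneg (Finset.sum_nonneg fun _ _ => by positivity) (by positivity))) hs.summable]
  refine tsum_congr fun n => ?_
  rw [lintegral_tsum fun k => by fun_prop]
  rcases Nat.eq_zero_or_pos n with rfl | hn
  · simp
  have h := (hasSum_inv_odd_mul_inv_odd hn).mul_left (1 / (2 * (n : ℝ) ^ 2))
  rw [← h.tsum_eq, ENNReal.ofReal_tsum_of_nonneg (fun k => by positivity) h.summable]
  refine tsum_congr fun k => ?_
  rw [lintegral_pow_Ioo _ (by positivity)]
  congr 1
  push_cast
  field_simp

end SineQuotient

/-! ### Reduction of the torus integral -/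

section TorusIntegral

open Filter Topology MeasureTheory Real Set

lemma setLIntegral_Icc_fin_succ {n : ℕ} {f : (Fin (n + 1) → ℝ) → ENNReal} (hf : Measurable f) :
    ∫⁻ t in Icc (0 : Fin (n + 1) → ℝ) 1, f t =
      ∫⁻ x in Icc (0 : ℝ) 1, ∫⁻ s in Icc (0 : Fin n → ℝ) 1, f (Fin.cons x s) := by
  have hm := (volume_preserving_piFinSuccAbove (fun _ : Fin (n + 1) => ℝ) 0).symm
  have he : ∀ p : ℝ × (Fin n → ℝ),
      (MeasurableEquiv.piFinSuccAbove (fun _ : Fin (n + 1) => ℝ) 0).symm p =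
        (Fin.cons p.1 p.2 : Fin (n + 1) → ℝ) := by
    intro p
    simp [MeasurableEquiv.piFinSuccAbove, Fin.insertNthEquiv]
  rw [← hm.setLIntegral_comp_preimage_emb (MeasurableEquiv.measurableEmbedding _)]
  have hpre : (MeasurableEquiv.piFinSuccAbove (fun _ : Fin (n + 1) => ℝ) 0).symm ⁻¹'
      Icc (0 : Fin (n + 1) → ℝ) 1 = Icc (0 : ℝ) 1 ×ˢ Icc (0 : Fin n → ℝ) 1 := by
    ext p
    simp only [mem_preimage, he, mem_Icc, mem_prod, Pi.le_def, Fin.forall_fin_succ, Fin.cons_zero,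
      Fin.cons_succ, Pi.zero_apply, Pi.one_apply]
    tauto
  rw [hpre, Measure.volume_eq_prod, ← Measure.prod_restrict, lintegral_prod]
  · simp only [he]
  · exact (hf.comp (MeasurableEquiv.measurable _)).aemeasurable

lemma setLIntegral_Icc_fin_three {f : (Fin 3 → ℝ) → ENNReal} (hf : Measurable f) :
    ∫⁻ t in Icc (0 : Fin 3 → ℝ) 1, f t =
      ∫⁻ x in Ioc (0 : ℝ) 1, ∫⁻ y in Ioc (0 : ℝ) 1, ∫⁻ z in Ioc (0 : ℝ) 1, f ![x, y, z] := by
  have hI : (volume : Measure ℝ).restrict (Ioc 0 1) = volume.restrict (Icc 0 1) :=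
    Measure.restrict_congr_set Ioc_ae_eq_Icc
  have h0 : ∀ g : (Fin 0 → ℝ) → ENNReal, ∫⁻ s in Icc (0 : Fin 0 → ℝ) 1, g s = g ![] := by
    intro g
    have : Icc (0 : Fin 0 → ℝ) 1 = univ := eq_univ_of_forall fun s => by
      simp [Subsingleton.elim s 0]
    rw [this, Measure.restrict_univ, volume_pi, Measure.pi_of_empty (x := ![]), lintegral_dirac]
  rw [setLIntegral_Icc_fin_succ hf, hI]
  refine lintegral_congr fun x => ?_
  have hf1 : Measurable fun s : Fin 2 → ℝ => f (Fin.cons x s) :=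
    hf.comp (measurable_pi_iff.2 (Fin.forall_fin_succ.2 ⟨by simp, fun i => by
      simpa using measurable_pi_apply i⟩))
  rw [setLIntegral_Icc_fin_succ hf1]
  refine lintegral_congr fun y => ?_
  have hf2 : Measurable fun s : Fin 1 → ℝ => f (Fin.cons x (Fin.cons y s)) :=
    hf1.comp (measurable_pi_iff.2 (Fin.forall_fin_succ.2 ⟨by simp, fun i => by
      simpa using measurable_pi_apply i⟩))
  rw [setLIntegral_Icc_fin_succ hf2]
  refine lintegral_congr fun z => ?_
  rw [h0]
  rfl

lemma norm_one_add_exp_eq (t : ℝ) :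
    ‖1 + Complex.exp (2 * π * Complex.I * t)‖ = 2 * |cos (π * t)| := by
  have e : 1 + Complex.exp (2 * π * Complex.I * t) =
      ((2 * cos (π * t) : ℝ) : ℂ) * Complex.exp ((π * t : ℝ) * Complex.I) := by
    have h1 : Complex.exp (2 * π * Complex.I * t) =
        Complex.exp ((π * t : ℝ) * Complex.I) * Complex.exp ((π * t : ℝ) * Complex.I) := by
      rw [← Complex.exp_add]; push_cast; congr 1; ring
    have h2 : Complex.exp (-((π * t : ℝ) : ℂ) * Complex.I) *
        Complex.exp ((π * t : ℝ) * Complex.I) = 1 := by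
      rw [← Complex.exp_add]; simp
    rw [h1, Complex.ofReal_mul 2, Complex.ofReal_cos, Complex.cos, Complex.ofReal_ofNat]
    linear_combination -h2
  rw [e, norm_mul, Complex.norm_exp_ofReal_mul_I, mul_one, Complex.norm_real, norm_mul]
  simp

/-- Substitution `x = 1/2 ± u/π`. -/
lemma lintegral_norm_one_add_exp (F : ℝ → ENNReal) :
    ∫⁻ x in Ioc (0 : ℝ) 1, F ‖1 + Complex.exp (2 * π * Complex.I * x)‖ =
      ENNReal.ofReal (2 / π) * ∫⁻ u in Ioo (0 : ℝ) (π / 2), F (2 * sin u) := by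
  have hp := pi_pos
  -- The sign s = 1 covers (1/2, 1) and s = -1 covers (0, 1/2); each half contributes the factor
  -- 1/π.
  have key : ∀ s : ℝ, |s| = 1 →
      ∫⁻ x in (fun u : ℝ => 1 / 2 + s * u / π) '' Ioo 0 (π / 2),
        F ‖1 + Complex.exp (2 * π * Complex.I * x)‖ =
      ENNReal.ofReal (1 / π) * ∫⁻ u in Ioo (0 : ℝ) (π / 2), F (2 * sin u) := by
    intro s hs
    have hs0 : s ≠ 0 := by rintro rfl; simp at hs
    rw [lintegral_image_eq_lintegral_abs_deriv_mul measurableSet_Ioo (f' := fun _ => s / π),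
      ← lintegral_const_mul' _ _ ENNReal.ofReal_ne_top]
    · refine setLIntegral_congr_fun measurableSet_Ioo fun u hu => ?_
      have hsin : 0 < sin u := sin_pos_of_pos_of_lt_pi hu.1 (by linarith [hu.2])
      have hcos : |cos (π * (1 / 2 + s * u / π))| = sin u := by
        rw [show π * (1 / 2 + s * u / π) = s * u + π / 2 by field_simp; ring, cos_add_pi_div_two,
          abs_neg]
        rcases abs_eq (zero_le_one) |>.1 hs with rfl | rfl
        · rw [one_mul, abs_of_pos hsin]
        · rw [neg_one_mul, sin_neg, abs_neg, abs_of_pos hsin]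
      rw [norm_one_add_exp_eq, hcos, abs_div, hs, abs_of_pos hp]
    · intro u _
      have h : HasDerivAt (fun u : ℝ => 1 / 2 + s * u / π) (s / π) u := by
        simpa using (((hasDerivAt_id u).const_mul s).div_const π).const_add (1 / 2)
      exact h.hasDerivWithinAt
    · intro u _ v _ h
      simpa [hs0, hp.ne'] using h
  have i1 : (fun u : ℝ => 1 / 2 + 1 * u / π) '' Ioo 0 (π / 2) = Ioo (1 / 2) 1 := by
    ext x
    constructor
    · rintro ⟨u, ⟨h1, h2⟩, rfl⟩
      have a1 : 0 < u / π := by positivity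
      have a2 : u / π < 1 / 2 := by rw [div_lt_iff₀ hp]; linarith
      dsimp only
      rw [one_mul]
      constructor <;> linarith
    · rintro ⟨h1, h2⟩
      refine ⟨π * (x - 1 / 2), ⟨mul_pos hp (by linarith), by nlinarith⟩, ?_⟩
      field_simp
      ring
  have i2 : (fun u : ℝ => 1 / 2 + -1 * u / π) '' Ioo 0 (π / 2) = Ioo 0 (1 / 2) := by
    ext x
    constructor
    · rintro ⟨u, ⟨h1, h2⟩, rfl⟩
      have a1 : 0 < u / π := by positivity
      have a2 : u / π < 1 / 2 := by rw [div_lt_iff₀ hp]; linarith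
      have a3 : -1 * u / π = -(u / π) := by ring
      dsimp only
      rw [a3]
      constructor <;> linarith
    · rintro ⟨h1, h2⟩
      refine ⟨π * (1 / 2 - x), ⟨mul_pos hp (by linarith), by nlinarith⟩, ?_⟩
      field_simp
      ring
  have k1 := key 1 (by simp)
  have k2 := key (-1) (by simp)
  rw [i1] at k1
  rw [i2] at k2
  rw [← Ioc_union_Ioc_eq_Ioc (show (0 : ℝ) ≤ 1 / 2 by norm_num) (show (1 / 2 : ℝ) ≤ 1 by norm_num),
    lintegral_union measurableSet_Ioc (Ioc_disjoint_Ioc_of_le le_rfl),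
    ← Measure.restrict_congr_set Ioo_ae_eq_Ioc, ← Measure.restrict_congr_set Ioo_ae_eq_Ioc, k1, k2,
    ← add_mul, ← ENNReal.ofReal_add (by positivity) (by positivity)]
  congr 2
  ring

/-- The diagonal is null, and Tonelli with the symmetry of H exchanges the two triangles. -/
lemma lintegral_triangle {s : Set ℝ} {H : ℝ → ℝ → ENNReal}
    (hH : Measurable (Function.uncurry H)) (hsymm : ∀ u v, H u v = H v u) :
    ∫⁻ u in s, ∫⁻ v in s, H u v = 2 * ∫⁻ u in s, ∫⁻ v in s ∩ Iio u, H u v := by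
  have hsplit : ∀ u, ∫⁻ v in s, H u v =
      (∫⁻ v in s, (Iio u).indicator (H u) v) + ∫⁻ v in s, (Ioi u).indicator (H u) v := by
    intro u
    have hm : Measurable (H u) := hH.comp measurable_prodMk_left
    rw [← lintegral_add_left (hm.indicator measurableSet_Iio)]
    refine lintegral_congr_ae ?_
    have hne : ∀ᵐ v ∂(volume.restrict s), v ≠ u :=
      ae_restrict_of_ae (Measure.ae_ne volume u)
    filter_upwards [hne] with v hv
    rcases lt_or_gt_of_ne hv with h | h
    · simp [indicator, h, h.not_gt]
    · simp [indicator, h, h.not_gt]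
  have hmlt : Measurable (fun p : ℝ × ℝ => (Iio p.1).indicator (H p.1) p.2) := by
    have h := hH.indicator (measurableSet_lt measurable_snd measurable_fst)
    exact h
  have hmgt : Measurable (fun p : ℝ × ℝ => (Ioi p.1).indicator (H p.1) p.2) := by
    have h := hH.indicator (measurableSet_lt measurable_fst measurable_snd)
    exact h
  simp only [hsplit]
  rw [lintegral_add_left hmlt.lintegral_prod_right']
  have hsw : ∫⁻ u in s, ∫⁻ v in s, (Ioi u).indicator (H u) v =
      ∫⁻ u in s, ∫⁻ v in s, (Iio u).indicator (H u) v := by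
    rw [lintegral_lintegral_swap hmgt.aemeasurable]
    refine lintegral_congr fun u => lintegral_congr fun v => ?_
    simp [indicator, hsymm u v]
  rw [hsw, ← two_mul]
  congr 1
  refine lintegral_congr fun u => ?_
  dsimp only
  rw [lintegral_indicator measurableSet_Iio, Measure.restrict_restrict measurableSet_Iio,
    inter_comm]

lemma integral_mul_log_two_sin_sq_nonneg :
    0 ≤ π ^ 4 / 192 + (2 * kummerLambda 4 (1 / 2) - π ^ 4 / 24 - π ^ 4 / 180) / 4 := by
  rw [← integral_mul_log_two_sin_sq]
  exact intervalIntegral.integral_nonneg (by positivity) fun u hu =>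
    mul_nonneg hu.1 (sq_nonneg _)

lemma sum_inv_odd_div_cube_nonneg :
    0 ≤ (π ^ 4 / 180 + (2 * kummerLambda 4 (1 / 2) - π ^ 4 / 24)) / 2 - π ^ 4 / 180 / 16 :=
  hasSum_sum_inv_odd_div_cube.nonneg fun n => mul_nonneg (by positivity)
    (div_nonneg (Finset.sum_nonneg fun _ _ => by positivity) (by positivity))

/-- Needed because `ENNReal.ofReal` truncates negative numbers. The value is 8/π² times a sum of the
two nonnegative quantities above. -/
lemma kummerLambda_value_nonneg :
    0 ≤ 12 / π ^ 2 * kummerLambda 4 (1 / 2) - π ^ 2 / 5 := by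
  have h : 12 / π ^ 2 * kummerLambda 4 (1 / 2) - π ^ 2 / 5 = 8 / π ^ 2 *
      ((π ^ 4 / 192 + (2 * kummerLambda 4 (1 / 2) - π ^ 4 / 24 - π ^ 4 / 180) / 4) +
      ((π ^ 4 / 180 + (2 * kummerLambda 4 (1 / 2) - π ^ 4 / 24)) / 2 - π ^ 4 / 180 / 16)) := by
    field_simp
    ring
  rw [h]
  exact mul_nonneg (by positivity)
    (add_nonneg integral_mul_log_two_sin_sq_nonneg sum_inv_odd_div_cube_nonneg)

lemma lintegral_circleMeanLogSq_sin :
    ∫⁻ u in Ioo (0 : ℝ) (π / 2), ∫⁻ v in Ioo (0 : ℝ) (π / 2),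
      circleMeanLogSq (2 * sin u) (2 * sin v) =
      2 * ENNReal.ofReal (3 / 2 * kummerLambda 4 (1 / 2) - π ^ 4 / 40) := by
  have hp := pi_pos
  rw [lintegral_triangle]
  rotate_left
  · exact measurable_circleMeanLogSq.comp (f := fun p : ℝ × ℝ => (2 * sin p.1, 2 * sin p.2))
      (by fun_prop)
  · exact fun u v => circleMeanLogSq_comm
  congr 1
  have hset : ∀ u ∈ Ioo (0 : ℝ) (π / 2), Ioo (0 : ℝ) (π / 2) ∩ Iio u = Ioo 0 u := by
    intro u hu
    ext v
    constructor
    · rintro ⟨h1, h2⟩; exact ⟨h1.1, h2⟩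
    · rintro ⟨h1, h2⟩; exact ⟨⟨h1, h2.trans hu.2⟩, h2⟩
  have hinner : ∀ u ∈ Ioo (0 : ℝ) (π / 2),
      ∫⁻ v in Ioo (0 : ℝ) (π / 2) ∩ Iio u, circleMeanLogSq (2 * sin u) (2 * sin v) =
      ENNReal.ofReal (u * log (2 * sin u) ^ 2) +
        ∫⁻ v in Ioo 0 u, ENNReal.ofReal (polyLog 2 ((sin v / sin u) ^ 2) / 2) := by
    intro u hu
    rw [hset u hu]
    have h1 : ∀ v ∈ Ioo 0 u, circleMeanLogSq (2 * sin u) (2 * sin v) =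
        ENNReal.ofReal (log (2 * sin u) ^ 2) +
          ENNReal.ofReal (polyLog 2 ((sin v / sin u) ^ 2) / 2) := by
      intro v hv
      have hv0 : 0 < sin v := sin_pos_of_pos_of_lt_pi hv.1 (by linarith [hv.2, hu.2])
      have hlt : sin v < sin u :=
        sin_lt_sin_of_lt_of_le_pi_div_two (by linarith [hv.1]) hu.2.le hv.2
      unfold circleMeanLogSq
      rw [lintegral_log_norm_add_mul_exp_sq (by linarith) (by linarith),
        mul_div_mul_left _ _ (two_ne_zero)]
    -- The term log²(2 sin u) does not depend on v; the length u of (0, u) is the weight in the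
    -- log-sine integral.
    rw [setLIntegral_congr_fun measurableSet_Ioo h1, lintegral_add_left measurable_const,
      setLIntegral_const, volume_Ioo, sub_zero, ← ENNReal.ofReal_mul (sq_nonneg _), mul_comm u]
  have hA : ∫⁻ u in Ioo (0 : ℝ) (π / 2), ENNReal.ofReal (u * log (2 * sin u) ^ 2) =
      ENNReal.ofReal (π ^ 4 / 192 +
        (2 * kummerLambda 4 (1 / 2) - π ^ 4 / 24 - π ^ 4 / 180) / 4) := by
    rw [← integral_mul_log_two_sin_sq, intervalIntegral.integral_of_le (by positivity),
      integral_Ioc_eq_integral_Ioo, ofReal_integral_eq_lintegral_ofReal]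
    · exact (intervalIntegrable_iff_integrableOn_Ioo_of_le (by positivity)).1
        intervalIntegrable_mul_log_two_sin_sq
    · filter_upwards [self_mem_ae_restrict measurableSet_Ioo] with u hu
      exact mul_nonneg hu.1.le (sq_nonneg _)
  rw [setLIntegral_congr_fun measurableSet_Ioo hinner, lintegral_add_left (by fun_prop), hA,
    lintegral_lintegral_polyLog_sin_div_sin, ← ENNReal.ofReal_add
      integral_mul_log_two_sin_sq_nonneg sum_inv_odd_div_cube_nonneg]
  congr 1
  ring

lemma lintegral_mahlerIntegrand :
    ∫⁻ t in Icc (0 : Fin 3 → ℝ) 1, ENNReal.ofReal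
      (mahlerIntegrand (fun (_ : Fin 2) (z : Fin 3 → ℂ) => 1 + z 0 + z 1 + z 2) t) =
      ENNReal.ofReal (12 / π ^ 2 * kummerLambda 4 (1 / 2) - π ^ 2 / 5) := by
  have hp := pi_pos
  have hmeas : Measurable fun t : Fin 3 → ℝ => ENNReal.ofReal
      (mahlerIntegrand (fun (_ : Fin 2) (z : Fin 3 → ℂ) => 1 + z 0 + z 1 + z 2) t) := by
    unfold mahlerIntegrand torusPoint
    fun_prop
  have hval : ∀ x y z : ℝ,
      mahlerIntegrand (fun (_ : Fin 2) (z : Fin 3 → ℂ) => 1 + z 0 + z 1 + z 2) ![x, y, z] =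
      log ‖1 + Complex.exp (2 * π * Complex.I * x) + Complex.exp (2 * π * Complex.I * y)
        + Complex.exp (2 * π * Complex.I * z)‖ ^ 2 := by
    intro x y z
    simp [mahlerIntegrand, torusPoint]
  rw [setLIntegral_Icc_fin_three hmeas]
  simp only [hval]
  have hx : ∀ x : ℝ, ∫⁻ y in Ioc (0 : ℝ) 1, ∫⁻ z in Ioc (0 : ℝ) 1, ENNReal.ofReal
      (log ‖1 + Complex.exp (2 * π * Complex.I * x) + Complex.exp (2 * π * Complex.I * y)
        + Complex.exp (2 * π * Complex.I * z)‖ ^ 2) =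
      ∫⁻ s in Ioc (0 : ℝ) 1, circleMeanLogSq ‖1 + Complex.exp (2 * π * Complex.I * x)‖
        ‖1 + Complex.exp (2 * π * Complex.I * s)‖ := by
    intro x
    have h1 : ∀ y : ℝ, ∫⁻ z in Ioc (0 : ℝ) 1, ENNReal.ofReal
        (log ‖1 + Complex.exp (2 * π * Complex.I * x) + Complex.exp (2 * π * Complex.I * y)
          + Complex.exp (2 * π * Complex.I * z)‖ ^ 2) =
        ∫⁻ s in Ioc (0 : ℝ) 1, ENNReal.ofReal (log ‖(1 + Complex.exp (2 * π * Complex.I * x))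
          + (1 + Complex.exp (2 * π * Complex.I * s)) *
            Complex.exp (2 * π * Complex.I * y)‖ ^ 2) := by
      intro y
      -- The substitution z = ys is the shift of the angle of z by y, allowed by periodicity.
      have hper : Function.Periodic (fun z : ℝ => ENNReal.ofReal
          (log ‖1 + Complex.exp (2 * π * Complex.I * x) + Complex.exp (2 * π * Complex.I * y)
            + Complex.exp (2 * π * Complex.I * z)‖ ^ 2)) 1 := by
        intro t
        have := periodic_exp_two_pi_mul_I t
        dsimp only at this ⊢
        rw [this]
      rw [← lintegral_Ioc_zero_one_add hper y]
      refine lintegral_congr fun s => ?_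
      congr 4
      rw [Complex.ofReal_add, mul_add (2 * π * Complex.I), Complex.exp_add]
      ring
    simp only [h1]
    -- Integrating over y first makes the inner integral a circle mean with a = 1 + x and b = 1 + s.
    rw [lintegral_lintegral_swap (by unfold Function.uncurry; fun_prop)]
    exact lintegral_congr fun s => lintegral_log_norm_eq_circleMeanLogSq _ _
  simp only [hx]
  rw [lintegral_norm_one_add_exp fun A => ∫⁻ s in Ioc (0 : ℝ) 1,
    circleMeanLogSq A ‖1 + Complex.exp (2 * π * Complex.I * s)‖]
  simp only [fun u : ℝ => lintegral_norm_one_add_exp (circleMeanLogSq (2 * sin u))]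
  rw [lintegral_const_mul' _ _ ENNReal.ofReal_ne_top, lintegral_circleMeanLogSq_sin,
    show (2 : ENNReal) = ENNReal.ofReal 2 by simp, ← ENNReal.ofReal_mul (by positivity),
    ← ENNReal.ofReal_mul (by positivity), ← ENNReal.ofReal_mul (by positivity)]
  congr 1
  field_simp
  ring

end TorusIntegral

/-! ### Absolute convergence and the value of the measure -/

theorem mainTheorem3 :
    MeasureTheory.IntegrableOn
        (mahlerIntegrand (fun (_ : Fin 2) (z : Fin 3 → ℂ) => 1 + z 0 + z 1 + z 2))
        (Set.Icc (0 : Fin 3 → ℝ) 1) ∧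
      higherMahlerMeasure 2 (fun z : Fin 3 → ℂ => 1 + z 0 + z 1 + z 2) =
        12 / Real.pi ^ 2 * kummerLambda 4 (1 / 2) - Real.pi ^ 2 / 5 := by
  have hmeas : Measurable
      (mahlerIntegrand (fun (_ : Fin 2) (z : Fin 3 → ℂ) => 1 + z 0 + z 1 + z 2)) := by
    unfold mahlerIntegrand torusPoint
    fun_prop
  have hnn : ∀ t,
      0 ≤ mahlerIntegrand (fun (_ : Fin 2) (z : Fin 3 → ℂ) => 1 + z 0 + z 1 + z 2) t := by
    intro t
    rw [mahlerIntegrand, Finset.prod_const]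
    exact even_two.pow_nonneg _
  constructor
  · refine ⟨hmeas.aestronglyMeasurable, ?_⟩
    -- The integrand is a square, so its extended-real integral decides integrability and also gives
    -- the value.
    rw [MeasureTheory.hasFiniteIntegral_iff_ofReal (MeasureTheory.ae_of_all _ hnn),
      lintegral_mahlerIntegrand]
    exact ENNReal.ofReal_lt_top
  · rw [higherMahlerMeasure, multipleMahlerMeasure,
      MeasureTheory.integral_eq_lintegral_of_nonneg_ae (MeasureTheory.ae_of_all _ hnn)
        hmeas.aestronglyMeasurable, lintegral_mahlerIntegrand,
      ENNReal.toReal_ofReal kummerLambda_value_nonneg]
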